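/- **Setting.** Let $N\ge 1$. Let $\mathbb F_N^+$ be the free unital semigroup on $1,\dots,N$ (words, with empty word $\emptyset$), ordered by $\prec$: shorter words come first, and words of equal length are ordered lexicographically. Let $\emptyset=\sigma_0\prec\sigma_1\prec\sigma_2\prec\cdots$ be its elements, and write $X_\sigma=X_{i_1}\cdots X_{i_k}$ for $\sigma=i_1\dots i_k$. Let $\mathcal P_N\subset\mathcal P_{2N}$ be the complex algebras of polynomials in the non-commuting variables $X_1,\dots,X_N$, respectively $X_1,\dots,X_{2N}$. Let $\mathcal J$ be the conjugate-linear anti-multiplicative involution of $\mathcal P_{2N}$ with $\mathcal J(X_k)=X_{N+k}$ and $\mathcal J(X_{N+k})=X_k$ for $1\le k\le N$. Let $$\mathcal A_S=\{1-\mathcal J(X_k)X_k\mid 1\le k\le N\}\cup\{\mathcal J(X_k)X_l\mid 1\le k,l\le N,\ k\ne l\},$$ and let $\pi:\mathcal P_{2N}\to\mathcal T_N(\mathcal A_S)$ be the quotient map onto the quotient by the two-sided ideal generated by $\mathcal A_S$. Let $\phi$ be a linear functional on $\mathcal T_N(\mathcal A_S)$ that is unital, $\phi(1)=1$, and strictly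 positive: $\phi(\pi(\mathcal J(P)P))>0$ for all $P\in\mathcal P_N$ with $\pi(P)\neq 0$. Put $\langle P,Q\rangle_\phi=\phi(\pi(\mathcal J(Q)P))$ for $P,Q\in\mathcal P_N$, and $$K_\phi(m,n)=\phi(\pi(\mathcal J(X_{\sigma_m})X_{\sigma_n})),\qquad m,n\ge 0 .$$ **Orthogonal polynomials.** Let $\varphi_n=\varphi_{\sigma_n}\in\mathcal P_N$, $n\ge0$, be the polynomials obtained from $X_{\sigma_0},X_{\sigma_1},\dots$ by the Gram–Schmidt procedure for $\langle\cdot,\cdot\rangle_\phi$ (orthonormal, with positive leading coefficients). **Parameters.** Let $\gamma_{k,j}$, $0\le k<j$, be the parameters of $K_\phi$: the unique complex numbers of modulus less than $1$ such that $$K_\phi(k,j)=K_\phi(k,k)^{1/2}\,[\,1\ 0\ \cdots\ 0\,]\;U_{k,j}\;[\,1\ 0\ \cdots\ 0\,]^t\,K_\phi(j,j)^{1/2},\qquad k\le j,$$ where $U_{k,k}=1$ and $U_{k,j}=R_{k,k+1}R_{k,k+2}\cdots R_{k,j}\,(U_{k+1,j}\oplus 1)$ for $k<j$. Here $R_{k,k+l}$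 is the $(j-k+1)\times(j-k+1)$ matrix that acts as $$\begin{bmatrix}\gamma_{k,k+l}&d_{k,k+l}\\ d_{k,k+l}&-\overline{\gamma}_{k,k+l}\end{bmatrix},\qquad d_{k,j}=(1-|\gamma_{k,j}|^2)^{1/2},$$ on the $l$-th and $(l+1)$-st coordinates and as the identity on the others. **The polynomials $\varphi_n^\sharp$.** Put $\varphi_0^\sharp=1$ and, for $n\ge1$ with $\sigma_n=k\sigma$ ($1\le k\le N$, $\sigma\in\mathbb F_N^+$), $$\varphi_n^\sharp=\frac1{d_{0,n}}\left(-\overline{\gamma}_{0,n}X_k\varphi_\sigma+\varphi_{n-1}^\sharp\right).$$ **Spectral factor and Szegő class.** Given Hilbert spaces $\mathcal F_n$, $n\ge0$, consider lower triangular arrays $\Theta=[\Theta_{k,j}]_{k,j\ge0}$ of operators $\Theta_{k,j}:\mathbb C\to\mathcal F_k$ ($\Theta_{k,j}=0$ for $k<j$) whose columns $c_j(\Theta)=[\Theta_{k,j}]_{k\ge 0}$ belong to $\bigoplus_{k}\mathcal F_k$. Such an array is *outer* if for every $k\ge 0$ the set $\{c_j(\Theta)\mathbb C\mid j\ge k\}$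 is total in $\bigoplus_{j\ge k}\mathcal F_j$, and $K_\Theta(k,j)=c_k(\Theta)^*c_j(\Theta)$. For kernels, $K_1\le K_2$ means that $K_2-K_1$ is positive semidefinite. The *spectral factor* $\Theta_\phi$ is the unique outer array, with each $\mathcal F_n\in\{\{0\},\mathbb C\}$ and $(\Theta_\phi)_{n,n}\ge 0$ for all $n$, such that $K_{\Theta_\phi}\le K_\phi$ and $K_{\Theta'}\le K_{\Theta_\phi}$ for every outer array $\Theta'$ (with any Hilbert spaces) such that $K_{\Theta'}\le K_\phi$. The functional $\phi$ belongs to the *Szegő class* if $(\Theta_\phi)_{n,n}>0$ for all $n\ge 0$. **Theorem.** Let $\phi$ be as above and belong to the Szegő class. 1. $\varphi_n\to 0$ as $n\to\infty$, coefficient-wise: for every word $w$ the coefficient of $X_w$ in $\varphi_n$ tends to $0$. 2. The array $\Theta_\phi$ is given by a formal power series $\sum_w\theta_wX_w$ in the non-commuting variables $X_1,\dots,X_N$: for all $m,n\ge 0$, $(\Theta_\phi)_{m,n}=\theta_\alpha$ if $\sigma_m=\sigma_n\alpha$ for some word $\alpha$, and $(\Theta_\phi)_{m,n}=0$ otherwise.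 Every $\varphi_n^\sharp$ is invertible in the algebra of formal power series in $X_1,\dots,X_N$, and $$(\varphi_n^\sharp)^{-1}\to\Theta_\phi=\sum_w\theta_wX_w\qquad(n\to\infty)$$ coefficient-wise. -/

import Mathlib

open Filter Topology
open scoped ComplexOrder

namespace TreeSzego

noncomputable section

/-! ### Words and their enumeration -/

/-- The free unital semigroup on `N` generators. -/
abbrev Word (N : ℕ) := FreeMonoid (Fin N)

/-- The `n`-th word in the order in which shorter words come first and words of the same length
are ordered lexicographically; `wordAt 0` is the empty word.
(The letters are the digits of `n` in bijective base `N`.) -/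
def wordAt (N : ℕ) [NeZero N] : ℕ → Word N
  | 0 => 1
  | n + 1 => wordAt N (n / N) * FreeMonoid.of (Fin.ofNat N n)
termination_by n => n
decreasing_by exact Nat.lt_succ_of_le (Nat.div_le_self n N)

/-- The position of a word in this order. -/
def wordIndex {N : ℕ} (w : Word N) : ℕ :=
  w.toList.foldl (fun a i => N * a + (i : ℕ) + 1) 0

theorem wordIndex_mul_of {N : ℕ} (w : Word N) (i : Fin N) :
    wordIndex (w * FreeMonoid.of i) = N * wordIndex w + (i : ℕ) + 1 := by
  simp [wordIndex, FreeMonoid.toList_mul]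

theorem wordIndex_wordAt {N : ℕ} [NeZero N] (n : ℕ) : wordIndex (wordAt N n) = n := by
  induction n using Nat.strong_induction_on with
  | _ n ih =>
    cases n with
    | zero => simp [wordAt, wordIndex]
    | succ n =>
      rw [wordAt, wordIndex_mul_of, ih _ (Nat.lt_succ_of_le (Nat.div_le_self n N))]
      simp [Nat.div_add_mod]

theorem wordAt_wordIndex {N : ℕ} [NeZero N] (w : Word N) : wordAt N (wordIndex w) = w := by
  have hN : 0 < N := NeZero.pos N
  obtain ⟨l, rfl⟩ := FreeMonoid.ofList.surjective w
  induction l using List.reverseRecOn with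
  | nil => simp [wordIndex, wordAt]
  | append_singleton l i ih =>
    rw [FreeMonoid.ofList_append, FreeMonoid.ofList_singleton, wordIndex_mul_of, wordAt]
    have h1 : (N * wordIndex (FreeMonoid.ofList l) + (i : ℕ)) / N
        = wordIndex (FreeMonoid.ofList l) := by
      rw [Nat.mul_add_div hN, Nat.div_eq_of_lt i.2, add_zero]
    rw [h1, ih]
    congr 2
    ext
    simp [Nat.mod_eq_of_lt i.2]

/-- The enumeration is increasing for the order described above. -/
theorem shortlex_wordAt {N : ℕ} [NeZero N] {m n : ℕ} (h : m < n) :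
    List.Shortlex (· < ·) (wordAt N m).toList (wordAt N n).toList := by
  induction n using Nat.strong_induction_on generalizing m with
  | _ n ih =>
    obtain ⟨n, rfl⟩ : ∃ k, n = k + 1 := ⟨n - 1, by omega⟩
    cases m with
    | zero =>
      apply List.Shortlex.of_length_lt
      rw [wordAt, wordAt]
      simp
    | succ m =>
      have hN : 0 < N := NeZero.pos N
      have hle : m / N ≤ n / N := Nat.div_le_div_right (by omega)
      rw [wordAt, wordAt, FreeMonoid.toList_mul, FreeMonoid.toList_mul, List.shortlex_def]
      rcases hle.lt_or_eq with hlt | heq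
      · have := ih (n / N) (Nat.lt_succ_of_le (Nat.div_le_self n N)) hlt
        rcases List.shortlex_def.1 this with h1 | ⟨h1, h2⟩
        · left
          simpa using h1
        · right
          refine ⟨by simp [h1], ?_⟩
          clear this
          generalize (wordAt N (m / N)).toList = a at h1 h2
          generalize (wordAt N (n / N)).toList = b at h1 h2
          induction h2 with
          | nil => simp at h1
          | cons _ ih2 => exact List.Lex.cons (ih2 (by simpa using h1))
          | rel hr => exact List.Lex.rel hr
      · right
        rw [heq]
        refine ⟨by simp, ?_⟩
        apply List.Lex.append_left
        apply List.Lex.rel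
        have e1 := Nat.div_add_mod m N
        have e2 := Nat.div_add_mod n N
        rw [heq] at e1
        rw [Fin.lt_def]
        simp only [Fin.ofNat]
        omega

/-! ### Polynomials in non-commuting variables, the involution, the quotient algebra -/

/-- Polynomials in the non-commuting variables `X_1, …, X_N`. -/
abbrev PolyN (N : ℕ) := MonoidAlgebra ℂ (Word N)

/-- Polynomials in the `2N` non-commuting variables `X_1, …, X_N` (letters `Sum.inl k`) and
`X_{N+1}, …, X_{2N}` (letters `Sum.inr k`). -/
abbrev Poly2N (N : ℕ) := MonoidAlgebra ℂ (FreeMonoid (Fin N ⊕ Fin N))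

/-- The involution on monomials: reverse the word and exchange `X_k` and `X_{N+k}`. -/
def invWord {N : ℕ} (w : FreeMonoid (Fin N ⊕ Fin N)) : FreeMonoid (Fin N ⊕ Fin N) :=
  FreeMonoid.ofList (w.toList.map Sum.swap).reverse

/-- The involution `𝒥`, extended conjugate-linearly. -/
def invol {N : ℕ} (Q : Poly2N N) : Poly2N N :=
  Q.coeff.sum fun w c => MonoidAlgebra.single (invWord w) (star c)

/-- The inclusion of the polynomials in `X_1, …, X_N`. -/
def incl {N : ℕ} : PolyN N →ₐ[ℂ] Poly2N N :=
  MonoidAlgebra.mapDomainAlgHom ℂ ℂ (FreeMonoid.map Sum.inl)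

/-- The monomial `X_σ`. -/
def mono {N : ℕ} (σ : Word N) : PolyN N := MonoidAlgebra.single σ 1

/-- The variable `X_k`. -/
def var {N : ℕ} (k : Fin N) : PolyN N := mono (FreeMonoid.of k)

/-- The quotient of the algebra of polynomials in `2N` variables by the two-sided ideal
generated by `A`. -/
abbrev QuotAlg {N : ℕ} (A : Set (Poly2N N)) := RingQuot (fun P Q : Poly2N N => P ∈ A ∧ Q = 0)

/-- The quotient map. -/
def proj {N : ℕ} (A : Set (Poly2N N)) : Poly2N N →ₐ[ℂ] QuotAlg A :=
  RingQuot.mkAlgHom ℂ (fun P Q : Poly2N N => P ∈ A ∧ Q = 0)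

/-- The relations `𝒜_S` of stationary processes on the Cayley tree:
`1 - 𝒥(X_k) X_k` for all `k`, and `𝒥(X_k) X_l` for all `k ≠ l`. -/
def stationaryRel (N : ℕ) : Set (Poly2N N) :=
  {P | ∃ k : Fin N, P = 1 - invol (incl (var k)) * incl (var k)} ∪
    {P | ∃ k l : Fin N, k ≠ l ∧ P = invol (incl (var k)) * incl (var l)}

/-- `⟨P, Q⟩_φ = φ(𝒥(Q) P)` for polynomials `P`, `Q` in `X_1, …, X_N`. -/
def form {N : ℕ} {A : Set (Poly2N N)} (φ : QuotAlg A →ₗ[ℂ] ℂ) (P Q : PolyN N) : ℂ :=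
  φ (proj A (invol (incl Q) * incl P))

/-- `φ` is strictly positive: `φ(𝒥(P) P) > 0` for every polynomial `P` in `X_1, …, X_N` that is
not in the ideal generated by the relations. -/
def StrictlyPositive {N : ℕ} {A : Set (Poly2N N)} (φ : QuotAlg A →ₗ[ℂ] ℂ) : Prop :=
  ∀ P : PolyN N, proj A (incl P) ≠ 0 → 0 < form φ P P

/-- The kernel `K_φ(σ, τ) = φ(𝒥(X_σ) X_τ)`, the words being numbered by `wordAt`. -/
def kernel {N : ℕ} [NeZero N] {A : Set (Poly2N N)} (φ : QuotAlg A →ₗ[ℂ] ℂ) : Matrix ℕ ℕ ℂ :=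
  fun m n => form φ (mono (wordAt N n)) (mono (wordAt N m))

/-! ### The parameters of a positive definite kernel -/

/-- `d = (1 - |γ|²)^{1/2}`. -/
def defect (γ : ℂ) : ℂ := (Real.sqrt (1 - ‖γ‖ ^ 2) : ℝ)

/-- The action of the elementary rotation `[γ, d; d, -conj γ]` on the coordinates `i`, `i + 1`. -/
def rot (γ : ℂ) (i : ℕ) (v : ℕ → ℂ) : ℕ → ℂ := fun m =>
  if m = i then γ * v i + defect γ * v (i + 1)
  else if m = i + 1 then defect γ * v i - star γ * v (i + 1)
  else v m

/-- `rotProd g k n` is the product of the rotations with parameters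
`g k (k+1), g k (k+2), …, g k (k+n)`, the `l`-th of which acts on the coordinates `l - 1`, `l`
(so that the last one is applied first). -/
def rotProd (g : ℕ → ℕ → ℂ) (k : ℕ) : ℕ → (ℕ → ℂ) → (ℕ → ℂ)
  | 0, v => v
  | n + 1, v => rotProd g k n (rot (g k (k + n + 1)) n v)

/-- The unitary operator `U_{k,k+n}` determined by the parameters:
`U_{k,k} = 1` and `U_{k,j} = R(g k (k+1)) ⋯ R(g k j) (U_{k+1,j} ⊕ 1)`. -/
def latticeU (g : ℕ → ℕ → ℂ) : ℕ → ℕ → (ℕ → ℂ) → (ℕ → ℂ)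
  | _, 0, v => v
  | k, n + 1, v => rotProd g k (n + 1) (latticeU g (k + 1) n v)

/-- `g` is the family of parameters `γ_{k,j}`, `k < j`, of the kernel `K`: numbers of modulus less
than one such that `K k j = K(k,k)^{1/2} [1 0 …] U_{k,j} [1 0 …]ᵗ K(j,j)^{1/2}`. The irrelevant
entries with `j ≤ k` are set to `0`. -/
def IsParamFamily (K : Matrix ℕ ℕ ℂ) (g : ℕ → ℕ → ℂ) : Prop :=
  (∀ k j, j ≤ k → g k j = 0) ∧ (∀ k j, k < j → ‖g k j‖ < 1) ∧
    ∀ k n, K k (k + n) = (Real.sqrt (K k k).re : ℝ) * latticeU g k n (Pi.single 0 1) 0 *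
      (Real.sqrt (K (k + n) (k + n)).re : ℝ)

/-- The family of parameters `γ_{k,j}` of `K` (for a strictly positive definite kernel there is
exactly one). -/
def param (K : Matrix ℕ ℕ ℂ) : ℕ → ℕ → ℂ := Classical.epsilon (IsParamFamily K)

/-! ### Orthogonal polynomials -/

/-- The orthogonal polynomials of `φ`: the Gram–Schmidt procedure applied to the monomials `X_σ`
in the order of their words, with positive leading coefficients. -/
def orthoPoly {N : ℕ} [NeZero N] {A : Set (Poly2N N)} (φ : QuotAlg A →ₗ[ℂ] ℂ) (n : ℕ) : PolyN N :=
  let e : PolyN N := mono (wordAt N n) -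
    ∑ i : Fin n, form φ (mono (wordAt N n)) (orthoPoly φ i) • orthoPoly φ i
  (((Real.sqrt (form φ e e).re)⁻¹ : ℝ) : ℂ) • e
termination_by n
decreasing_by all_goals exact i.2

/-- The polynomial `X_k φ_σ` attached to the word `kσ` (and `0` for the empty word). -/
def shiftedPoly {N : ℕ} [NeZero N] {A : Set (Poly2N N)} (φ : QuotAlg A →ₗ[ℂ] ℂ) :
    List (Fin N) → PolyN N
  | [] => 0
  | k :: σ => var k * orthoPoly φ (wordIndex (FreeMonoid.ofList σ))

/-- The polynomials `φ_n^♯`: `φ_∅^♯ = 1`, and, with `γ_{kσ} = γ_{∅,kσ}`,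
`φ_{kσ}^♯ = d_{kσ}⁻¹ (- conj γ_{kσ} X_k φ_σ + φ_{kσ-1}^♯)`, where `kσ - 1` is the predecessor
of the word `kσ`. -/
def sharpPoly {N : ℕ} [NeZero N] {A : Set (Poly2N N)} (φ : QuotAlg A →ₗ[ℂ] ℂ) : ℕ → PolyN N
  | 0 => 1
  | n + 1 => (defect (param (kernel φ) 0 (n + 1)))⁻¹ •
      (-(star (param (kernel φ) 0 (n + 1)) • shiftedPoly φ (wordAt N (n + 1)).toList) +
        sharpPoly φ n)

/-! ### The spectral factor of a positive definite kernel on `ℕ` -/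

/-- Lower triangular arrays with entries in the Hilbert spaces `F k` (operators from `ℂ` to `F k`
are identified with elements of `F k`), with square summable columns. -/
structure TriArray (F : ℕ → Type) [∀ k, NormedAddCommGroup (F k)]
    [∀ k, InnerProductSpace ℂ (F k)] where
  entry : ∀ k : ℕ, ℕ → F k
  lower : ∀ k j, k < j → entry k j = 0
  memlp : ∀ j, Memℓp (fun k => entry k j) 2

variable {F : ℕ → Type} [∀ k, NormedAddCommGroup (F k)] [∀ k, InnerProductSpace ℂ (F k)]

/-- The `j`-th column, an element of the Hilbert space direct sum of the `F k`. -/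
def TriArray.col (T : TriArray F) (j : ℕ) : lp F 2 := ⟨fun k => T.entry k j, T.memlp j⟩

/-- The kernel `(k, j) ↦ c_k* c_j` of an array with columns `c_j`. -/
def TriArray.toKernel (T : TriArray F) : Matrix ℕ ℕ ℂ := fun k j => inner ℂ (T.col k) (T.col j)

/-- The array is outer: for all `k` the columns `c_j`, `j ≥ k`, are total in the direct sum
of the `F i`, `i ≥ k`. -/
def TriArray.IsOuter (T : TriArray F) : Prop :=
  ∀ (k : ℕ) (x : lp F 2), (∀ i < k, x i = 0) →
    x ∈ (Submodule.span ℂ (T.col '' Set.Ici k)).topologicalClosure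

end

/-- `Θ` is the spectral factor of `K`: an outer lower triangular array with non-negative diagonal,
the Hilbert spaces being `{0}` or `ℂ`, whose kernel is below `K` and is the largest among the
kernels below `K` of outer arrays. -/
def IsSpectralFactor (K : Matrix ℕ ℕ ℂ) (Θ : Matrix ℕ ℕ ℂ) : Prop :=
  ∃ (F : ℕ → Submodule ℂ ℂ) (T : TriArray (fun k => F k)),
    (∀ k j, Θ k j = (T.entry k j : ℂ)) ∧ (∀ k, 0 ≤ Θ k k) ∧ T.IsOuter ∧
    (K - T.toKernel).PosSemidef ∧
    ∀ (F' : ℕ → Type) [∀ k, NormedAddCommGroup (F' k)] [∀ k, InnerProductSpace ℂ (F' k)]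
      [∀ k, CompleteSpace (F' k)] (T' : TriArray F'),
      T'.IsOuter → (K - T'.toKernel).PosSemidef → (T.toKernel - T'.toKernel).PosSemidef

/-- The spectral factor of `K` (for a positive definite kernel there is exactly one). -/
noncomputable def spectralFactor (K : Matrix ℕ ℕ ℂ) : Matrix ℕ ℕ ℂ :=
  Classical.epsilon (IsSpectralFactor K)

/-- `K` is in the Szegő class: the diagonal entries of its spectral factor are positive. -/
def SzegoClass (K : Matrix ℕ ℕ ℂ) : Prop :=
  ∃ Θ, IsSpectralFactor K Θ ∧ ∀ n, 0 < Θ n n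

/-! ### Formal power series in non-commuting variables -/

/-- Formal power series in the non-commuting variables `X_1, …, X_N`. -/
abbrev Series (N : ℕ) := Word N → ℂ

/-- The series `1`. -/
def oneSeries (N : ℕ) : Series N := fun w => if w.length = 0 then 1 else 0

/-- The product of series: the coefficient at `w` is the sum of `f u * g v` over all
factorizations `w = u v`. -/
def mulSeries {N : ℕ} (f g : Series N) : Series N := fun w =>
  ∑ i ∈ Finset.range (w.length + 1),
    f (FreeMonoid.ofList (w.toList.take i)) * g (FreeMonoid.ofList (w.toList.drop i))

/-- A polynomial as a series. -/
def toSeries {N : ℕ} (P : PolyN N) : Series N := fun w => P.coeff w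

/-- `g` is the (two-sided) inverse of the series `f`. -/
def IsInverse {N : ℕ} (f g : Series N) : Prop :=
  mulSeries f g = oneSeries N ∧ mulSeries g f = oneSeries N

/-- The lower triangular array of a series `θ`: the entry at the words `(σ, τ)` is `θ α` if
`σ = τ α`, and `0` if `τ` is not a prefix of `σ`. -/
def seriesArray {N : ℕ} [NeZero N] (θ : Series N) : Matrix ℕ ℕ ℂ := fun m n =>
  if (wordAt N n).toList <+: (wordAt N m).toList then
    θ (FreeMonoid.ofList ((wordAt N m).toList.drop (wordAt N n).length))
  else 0

end TreeSzego

open TreeSzego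

namespace TreeSzego

/-! Strict positivity makes the polynomials an inner product space with the monomials as a basis
`v`, because they embed into the quotient algebra (`eq_zero_of_proj_incl_eq_zero`). There φ_n is the
forward vector `fwd v 0 n`. By the relations, left multiplications by the variables are isometries
with mutually orthogonal ranges (`form_var_mul`), and they preserve the order of the words. Hence
X_k φ_σ is a forward vector starting at index 1, and the recursion for φ_n^♯ is the backward half of
the Szegő recursion: φ_n^♯ is the normalized component of 1 orthogonal to X_{σ_1}, …, X_{σ_n}
(`map_sharpPoly`).

An array whose kernel is below K_φ is a lower triangular contraction C sending `v j` to the j-th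
column. Each coordinate of C φ_n tends to 0 by Bessel's inequality, and the nonzero diagonal allows
solving successively for the coefficients of φ_n (`IsSpectralFactor.tendsto_repr_fwd`). This is the
first claim.

For the second, the vectors u_k = X_σ φ_k^♯ are unit vectors supported on the words from σ on, and
each later monomial is eventually orthogonal to them (`IsPeakSeq`). A weak limit of the u_k defines
a one-row outer array below K_φ, so maximality forces the diagonal entry of the spectral factor at σ
to be the limit of the reciprocal leading coefficients (`IsPeakSeq.tendsto_ultrafilter`). Then C u_k
converges in norm to the coordinate vector at σ, and the Cauchy–Schwarz inequality for the defect
form of C identifies the row of the spectral factor at σ with lim ⟨u_k, v_j⟩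
(`IsPeakSeq.tendsto_of_diag`). Cancelling common first letters in these limits shows that the array
comes from a series θ. For empty σ, the coordinates of C φ_k^♯ are the coefficients of the series
φ_k^♯ θ, which therefore tends to 1; `tendsto_inverse` turns this into convergence of the inverses.
-/

/-! ### Forward and backward orthonormal vectors -/

section Recursion

variable {E : Type*} [NormedAddCommGroup E] [InnerProductSpace ℂ E]

/-- The Szegő recursion for the sequence `v`: the pair of the normalized components of `v (k + n)`
orthogonal to `v k, …, v (k + n - 1)`, and of `v k` orthogonal to `v (k + 1), …, v (k + n)`. -/
noncomputable def szegoPair (v : ℕ → E) : ℕ → ℕ → E × E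
  | 0, k => (((‖v k‖⁻¹ : ℝ) : ℂ) • v k, ((‖v k‖⁻¹ : ℝ) : ℂ) • v k)
  | n + 1, k =>
    let f := (szegoPair v n (k + 1)).1
    let b := (szegoPair v n k).2
    let g := inner ℂ b f
    ((defect g)⁻¹ • (f - g • b), (defect g)⁻¹ • (b - star g • f))

/-- The normalized component of `v (k + n)` orthogonal to `v k, …, v (k + n - 1)`. -/
noncomputable def fwd (v : ℕ → E) (k n : ℕ) : E := (szegoPair v n k).1

/-- The normalized component of `v k` orthogonal to `v (k + 1), …, v (k + n)`. -/
noncomputable def bwd (v : ℕ → E) (k n : ℕ) : E := (szegoPair v n k).2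

/-- The parameter attached to the indices `k` and `k + n + 1`. -/
noncomputable def refl (v : ℕ → E) (k n : ℕ) : ℂ := inner ℂ (bwd v k n) (fwd v (k + 1) n)

theorem fwd_zero (v : ℕ → E) (k : ℕ) : fwd v k 0 = ((‖v k‖⁻¹ : ℝ) : ℂ) • v k := rfl

theorem bwd_zero (v : ℕ → E) (k : ℕ) : bwd v k 0 = ((‖v k‖⁻¹ : ℝ) : ℂ) • v k := rfl

theorem fwd_succ (v : ℕ → E) (k n : ℕ) : fwd v k (n + 1) =
    (defect (refl v k n))⁻¹ • (fwd v (k + 1) n - refl v k n • bwd v k n) := rfl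

theorem bwd_succ (v : ℕ → E) (k n : ℕ) : bwd v k (n + 1) =
    (defect (refl v k n))⁻¹ • (bwd v k n - star (refl v k n) • fwd v (k + 1) n) := rfl

theorem inner_eq_sum_repr (v : Module.Basis ℕ ℂ E) (x y : E) :
    inner ℂ x y = (v.repr x).sum fun i c => star c * inner ℂ (v i) y := by
  conv_lhs => rw [← v.linearCombination_repr x]
  rw [Finsupp.linearCombination_apply, Finsupp.sum, sum_inner]
  simp only [inner_smul_left]
  rfl

/-- If `y` is orthogonal to all basis vectors involved in `x` except `v k`, only the `k`-th
coordinate of `x` matters. -/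
theorem inner_eq_repr_mul (v : Module.Basis ℕ ℂ E) {x y : E} (k : ℕ)
    (h : ∀ i, i ≠ k → v.repr x i = 0 ∨ inner ℂ (v i) y = 0) :
    inner ℂ x y = star (v.repr x k) * inner ℂ (v k) y := by
  rw [inner_eq_sum_repr v, Finsupp.sum_eq_single k]
  · intro i _ hik
    rcases h i hik with h | h <;> simp [h]
  · simp

theorem defect_sq {g : ℂ} (hg : ‖g‖ < 1) : defect g * defect g = 1 - g * star g := by
  rw [defect, ← Complex.ofReal_mul, Real.mul_self_sqrt (by nlinarith [norm_nonneg g])]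
  have : g * star g = ((‖g‖ ^ 2 : ℝ) : ℂ) := by
    rw [Complex.star_def, Complex.mul_conj, Complex.normSq_eq_norm_sq]
  rw [this]
  push_cast
  ring

theorem defect_pos {g : ℂ} (hg : ‖g‖ < 1) : 0 < defect g := by
  rw [defect, Complex.zero_lt_real]
  apply Real.sqrt_pos.2
  nlinarith [norm_nonneg g]

theorem norm_sub_inner_smul_sq {f b : E} (hf : ‖f‖ = 1) (hb : ‖b‖ = 1) :
    ‖f - inner ℂ b f • b‖ ^ 2 = 1 - ‖inner ℂ b f‖ ^ 2 := by
  have h1 : inner ℂ (f - inner ℂ b f • b) (f - inner ℂ b f • b)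
      = ((1 - ‖inner ℂ b f‖ ^ 2 : ℝ) : ℂ) := by
    simp only [inner_sub_left, inner_sub_right, inner_smul_left, inner_smul_right]
    rw [inner_self_eq_norm_sq_to_K, inner_self_eq_norm_sq_to_K, hf, hb, ← inner_conj_symm f b]
    have := Complex.mul_conj (inner ℂ b f)
    rw [Complex.normSq_eq_norm_sq] at this
    push_cast at this ⊢
    rw [← this]
    ring
  rw [inner_self_eq_norm_sq_to_K] at h1
  apply Complex.ofReal_injective
  rw [← h1]
  push_cast
  rfl

theorem norm_inner_lt_one {f b : E} (hf : ‖f‖ = 1) (hb : ‖b‖ = 1) (h : f - inner ℂ b f • b ≠ 0) :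
    ‖inner ℂ b f‖ < 1 := by
  have h1 := norm_sub_inner_smul_sq hf hb
  have h2 : 0 < ‖f - inner ℂ b f • b‖ := norm_pos_iff.2 h
  have h3 := norm_nonneg (inner ℂ b f)
  nlinarith

theorem norm_defect_smul {f b : E} (hf : ‖f‖ = 1) (hb : ‖b‖ = 1) (h : ‖inner ℂ b f‖ < 1) :
    ‖(defect (inner ℂ b f))⁻¹ • (f - inner ℂ b f • b)‖ = 1 := by
  have h1 := norm_sub_inner_smul_sq hf hb
  have h2 : ‖f - inner ℂ b f • b‖ = Real.sqrt (1 - ‖inner ℂ b f‖ ^ 2) := by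
    rw [← h1, Real.sqrt_sq (norm_nonneg _)]
  have h3 : 0 < Real.sqrt (1 - ‖inner ℂ b f‖ ^ 2) :=
    Real.sqrt_pos.2 (by nlinarith [norm_nonneg (inner ℂ b f)])
  rw [norm_smul, h2, norm_inv, defect, Complex.norm_real, Real.norm_of_nonneg h3.le,
    inv_mul_cancel₀ h3.ne']

/-- The properties that characterize the forward vectors. -/
structure IsFwd (v : Module.Basis ℕ ℂ E) (k n : ℕ) (x : E) : Prop where
  norm_eq : ‖x‖ = 1
  repr_eq_zero : ∀ i, ¬ (k ≤ i ∧ i ≤ k + n) → v.repr x i = 0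
  repr_pos : 0 < v.repr x (k + n)
  inner_eq_zero : ∀ i, k ≤ i → i < k + n → inner ℂ (v i) x = 0

/-- The properties that characterize the backward vectors. -/
structure IsBwd (v : Module.Basis ℕ ℂ E) (k n : ℕ) (x : E) : Prop where
  norm_eq : ‖x‖ = 1
  repr_eq_zero : ∀ i, ¬ (k ≤ i ∧ i ≤ k + n) → v.repr x i = 0
  repr_pos : 0 < v.repr x k
  inner_eq_zero : ∀ i, k < i → i ≤ k + n → inner ℂ (v i) x = 0

/-- Equality in Cauchy–Schwarz would make `f` a multiple of `b`, but `b` has a nonzero coordinate at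
`k` and `f` has none. -/
theorem norm_refl_lt_one_of (v : Module.Basis ℕ ℂ E) {k n : ℕ} {f b : E}
    (hf : IsFwd v (k + 1) n f) (hb : IsBwd v k n b) : ‖inner ℂ b f‖ < 1 := by
  apply norm_inner_lt_one hf.norm_eq hb.norm_eq
  intro h
  have h1 : v.repr (f - inner ℂ b f • b) k = 0 := by rw [h]; simp
  have h2 : v.repr f k = 0 := hf.repr_eq_zero k (by omega)
  simp only [map_sub, map_smul, Finsupp.coe_sub, Finsupp.coe_smul, Pi.sub_apply, Pi.smul_apply,
    h2, smul_eq_mul, zero_sub, neg_eq_zero, mul_eq_zero] at h1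
  rcases h1 with h1 | h1
  · rw [h1, zero_smul, sub_zero] at h
    have := hf.norm_eq
    simp [h] at this
  · exact hb.repr_pos.ne' h1

theorem inner_bwd_left (v : Module.Basis ℕ ℂ E) {k n : ℕ} {b : E} (hb : IsBwd v k n b) {y : E}
    (hy : ∀ i, k < i → i ≤ k + n → inner ℂ (v i) y = 0) :
    inner ℂ b y = v.repr b k * inner ℂ (v k) y := by
  rw [inner_eq_repr_mul v k]
  · rw [IsSelfAdjoint.of_nonneg hb.repr_pos.le]
  · intro i hi
    by_cases h : k ≤ i ∧ i ≤ k + n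
    · exact Or.inr (hy i (by omega) h.2)
    · exact Or.inl (hb.repr_eq_zero i h)

/-- The condition ‖b‖ = 1, expanded in the basis: only the coordinate at `k` contributes. -/
theorem IsBwd.repr_mul_inner {v : Module.Basis ℕ ℂ E} {k n : ℕ} {b : E} (hb : IsBwd v k n b) :
    v.repr b k * inner ℂ b (v k) = 1 := by
  have h1 := inner_bwd_left v hb hb.inner_eq_zero
  rw [inner_self_eq_norm_sq_to_K, hb.norm_eq] at h1
  have h2 := congrArg star h1
  rw [star_mul', IsSelfAdjoint.of_nonneg hb.repr_pos.le, Complex.star_def, inner_conj_symm] at h2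
  refine h2.symm.trans ?_
  simp

theorem inner_fwd_left (v : Module.Basis ℕ ℂ E) {k n : ℕ} {f : E} (hf : IsFwd v k n f) {y : E}
    (hy : ∀ i, k ≤ i → i < k + n → inner ℂ (v i) y = 0) :
    inner ℂ f y = v.repr f (k + n) * inner ℂ (v (k + n)) y := by
  rw [inner_eq_repr_mul v (k + n)]
  · rw [IsSelfAdjoint.of_nonneg hf.repr_pos.le]
  · intro i hi
    by_cases h : k ≤ i ∧ i ≤ k + n
    · exact Or.inr (hy i h.1 (by omega))
    · exact Or.inl (hf.repr_eq_zero i h)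

/-- Both `f` and `b` are already orthogonal to the inner vectors `v (k+1), …, v (k+n)`, so only
orthogonality to `v k` has to be arranged. On such vectors, pairing with `v k` is proportional to
pairing with `b`. -/
theorem isFwd_step (v : Module.Basis ℕ ℂ E) {k n : ℕ} {f b : E}
    (hf : IsFwd v (k + 1) n f) (hb : IsBwd v k n b) :
    IsFwd v k (n + 1) ((defect (inner ℂ b f))⁻¹ • (f - inner ℂ b f • b)) := by
  have hg := norm_refl_lt_one_of v hf hb
  refine ⟨norm_defect_smul hf.norm_eq hb.norm_eq hg, ?_, ?_, ?_⟩
  · intro i hi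
    simp [hf.repr_eq_zero i (by omega), hb.repr_eq_zero i (by omega)]
  · have h1 : 0 < v.repr f (k + (n + 1)) := by
      have := hf.repr_pos
      rwa [show k + 1 + n = k + (n + 1) by omega] at this
    have : v.repr ((defect (inner ℂ b f))⁻¹ • (f - inner ℂ b f • b)) (k + (n + 1))
        = (defect (inner ℂ b f))⁻¹ * v.repr f (k + (n + 1)) := by
      simp [hb.repr_eq_zero (k + (n + 1)) (by omega)]
    rw [this]
    exact mul_pos (inv_pos.2 (defect_pos hg)) h1
  · intro i h1 h2
    rw [inner_smul_right, inner_sub_right, inner_smul_right]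
    rcases h1.eq_or_lt with rfl | h1
    · have e1 := inner_bwd_left v hb (fun i h1 h2 => hf.inner_eq_zero i (by omega) (by omega))
      have e2 := inner_bwd_left v hb hb.inner_eq_zero
      rw [inner_self_eq_norm_sq_to_K, hb.norm_eq] at e2
      have hc := hb.repr_pos.ne'
      have : v.repr b k * (inner ℂ (v k) f - inner ℂ b f * inner ℂ (v k) b) = 0 := by
        rw [mul_sub, ← e1, mul_left_comm, ← e2]; simp
      rw [(mul_eq_zero.1 this).resolve_left hc, mul_zero]
    · rw [hf.inner_eq_zero i h1 (by omega), hb.inner_eq_zero i h1 (by omega)]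
      simp

theorem isBwd_step (v : Module.Basis ℕ ℂ E) {k n : ℕ} {f b : E}
    (hf : IsFwd v (k + 1) n f) (hb : IsBwd v k n b) :
    IsBwd v k (n + 1) ((defect (inner ℂ b f))⁻¹ • (b - star (inner ℂ b f) • f)) := by
  have hg := norm_refl_lt_one_of v hf hb
  have hstar : star (inner ℂ b f) = inner ℂ f b := inner_conj_symm f b
  have hd : defect (inner ℂ f b) = defect (inner ℂ b f) := by
    rw [defect, defect, norm_inner_symm]
  refine ⟨?_, ?_, ?_, ?_⟩
  · rw [hstar, ← hd]
    exact norm_defect_smul hb.norm_eq hf.norm_eq (by rwa [norm_inner_symm])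
  · intro i hi
    simp [hf.repr_eq_zero i (by omega), hb.repr_eq_zero i (by omega)]
  · have : v.repr ((defect (inner ℂ b f))⁻¹ • (b - star (inner ℂ b f) • f)) k
        = (defect (inner ℂ b f))⁻¹ * v.repr b k := by
      simp [hf.repr_eq_zero k (by omega)]
    rw [this]
    exact mul_pos (inv_pos.2 (defect_pos hg)) hb.repr_pos
  · intro i h1 h2
    rw [inner_smul_right, inner_sub_right, inner_smul_right]
    rcases (show i ≤ k + 1 + n by omega).eq_or_lt with rfl | h2
    · have e1 := inner_fwd_left v hf (fun i h1 h2 => hb.inner_eq_zero i (by omega) (by omega))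
      have e2 := inner_fwd_left v hf hf.inner_eq_zero
      rw [inner_self_eq_norm_sq_to_K, hf.norm_eq] at e2
      have hc := hf.repr_pos.ne'
      have : v.repr f (k + 1 + n) * (inner ℂ (v (k + 1 + n)) b
          - star (inner ℂ b f) * inner ℂ (v (k + 1 + n)) f) = 0 := by
        rw [mul_sub, ← e1, mul_left_comm, ← e2, hstar]; simp
      rw [(mul_eq_zero.1 this).resolve_left hc, mul_zero]
    · rw [hf.inner_eq_zero i (by omega) h2, hb.inner_eq_zero i h1 (by omega)]
      simp

theorem isFwd_isBwd (v : Module.Basis ℕ ℂ E) (n : ℕ) :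
    ∀ k, IsFwd v k n (fwd v k n) ∧ IsBwd v k n (bwd v k n) := by
  induction n with
  | zero =>
    intro k
    have h0 : 0 < ‖v k‖ := norm_pos_iff.2 (v.ne_zero k)
    have h1 : ‖((‖v k‖⁻¹ : ℝ) : ℂ) • v k‖ = 1 := by
      rw [norm_smul, Complex.norm_real, norm_inv, norm_norm, inv_mul_cancel₀ h0.ne']
    have h2 : ∀ i, ¬ (k ≤ i ∧ i ≤ k + 0) → v.repr (((‖v k‖⁻¹ : ℝ) : ℂ) • v k) i = 0 := by
      intro i hi
      simp [Finsupp.single_eq_of_ne (show i ≠ k by omega)]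
    have h3 : 0 < v.repr (((‖v k‖⁻¹ : ℝ) : ℂ) • v k) k := by
      simp only [map_smul, Module.Basis.repr_self, Finsupp.coe_smul, Pi.smul_apply,
        Finsupp.single_eq_same, smul_eq_mul, mul_one, Complex.zero_lt_real]
      exact inv_pos.2 h0
    exact ⟨⟨h1, h2, h3, by omega⟩, ⟨h1, h2, h3, by omega⟩⟩
  | succ n ih =>
    exact fun k => ⟨isFwd_step v (ih (k + 1)).1 (ih k).2, isBwd_step v (ih (k + 1)).1 (ih k).2⟩

theorem isFwd_fwd (v : Module.Basis ℕ ℂ E) (k n : ℕ) : IsFwd v k n (fwd v k n) :=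
  (isFwd_isBwd v n k).1

theorem isBwd_bwd (v : Module.Basis ℕ ℂ E) (k n : ℕ) : IsBwd v k n (bwd v k n) :=
  (isFwd_isBwd v n k).2

theorem norm_refl_lt_one (v : Module.Basis ℕ ℂ E) (k n : ℕ) : ‖refl v k n‖ < 1 :=
  norm_refl_lt_one_of v (isFwd_fwd v (k + 1) n) (isBwd_bwd v k n)

/-- The forward vectors are determined by their properties. -/
theorem IsFwd.unique (v : Module.Basis ℕ ℂ E) {k n : ℕ} {x y : E} (hx : IsFwd v k n x)
    (hy : IsFwd v k n y) : x = y := by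
  have hc := hx.repr_pos
  have hd := hy.repr_pos
  set c := v.repr x (k + n)
  set d := v.repr y (k + n)
  -- The top coordinates cancel, and the difference is orthogonal to all lower basis vectors
  -- involved, so it is orthogonal to itself.
  have h0 : d • x - c • y = 0 := by
    rw [← inner_self_eq_zero (𝕜 := ℂ), inner_eq_repr_mul v (k + n)]
    · simp [c, d, mul_comm]
    · intro i hi
      by_cases h : k ≤ i ∧ i ≤ k + n
      · right
        rw [inner_sub_right, inner_smul_right, inner_smul_right,
          hx.inner_eq_zero i h.1 (by omega), hy.inner_eq_zero i h.1 (by omega)]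
        simp
      · left
        simp [hx.repr_eq_zero i h, hy.repr_eq_zero i h]
  have h1 := sub_eq_zero.1 h0
  have h2 : ‖d‖ = ‖c‖ := by
    have := congrArg norm h1
    rwa [norm_smul, norm_smul, hx.norm_eq, hy.norm_eq, mul_one, mul_one] at this
  have h3 : d = c := by
    rw [Complex.eq_coe_norm_of_nonneg hd.le, Complex.eq_coe_norm_of_nonneg hc.le, h2]
  rw [h3] at h1
  exact smul_right_injective E hc.ne' h1

/-- The first of the two rotation formulas. -/
theorem fwd_succ_left (v : Module.Basis ℕ ℂ E) (k n : ℕ) : fwd v (k + 1) n =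
    refl v k n • bwd v k n + defect (refl v k n) • fwd v k (n + 1) := by
  rw [fwd_succ, smul_smul, mul_inv_cancel₀ (defect_pos (norm_refl_lt_one v k n)).ne', one_smul]
  abel

/-- The second of the two rotation formulas. -/
theorem bwd_succ_eq (v : Module.Basis ℕ ℂ E) (k n : ℕ) : bwd v k (n + 1) =
    defect (refl v k n) • bwd v k n - star (refl v k n) • fwd v k (n + 1) := by
  have hd := (defect_pos (norm_refl_lt_one v k n)).ne'
  have h2 := defect_sq (norm_refl_lt_one v k n)
  apply smul_right_injective E hd
  simp only
  rw [bwd_succ, fwd_succ_left v, smul_smul, mul_inv_cancel₀ hd, one_smul, smul_sub, smul_smul, h2,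
    sub_smul, one_smul, smul_add, smul_smul, smul_smul, smul_smul, mul_comm (star _) (refl v k n),
    mul_comm (star _) (defect _)]
  abel

end Recursion

/-! ### The parameters of a positive definite kernel -/

theorem rotProd_apply_of_lt (g : ℕ → ℕ → ℂ) (k : ℕ) {n m : ℕ} (h : n < m) (a : ℕ → ℂ) :
    rotProd g k n a m = a m := by
  induction n generalizing a with
  | zero => rfl
  | succ n ih =>
    rw [rotProd, ih (by omega), rot, if_neg (by omega), if_neg (by omega)]

theorem latticeU_apply_of_lt (g : ℕ → ℕ → ℂ) (k : ℕ) {n m : ℕ} (h : n < m) :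
    latticeU g k n (Pi.single 0 1) m = 0 := by
  induction n generalizing k with
  | zero => rw [latticeU, Pi.single_eq_of_ne (by omega)]
  | succ n ih => rw [latticeU, rotProd_apply_of_lt g k h, ih _ (by omega)]

/-- The last coordinate of a product of rotations applied to a vector with vanishing last
coordinate. -/
theorem rotProd_last (g : ℕ → ℕ → ℂ) (k n : ℕ) {a : ℕ → ℂ} (ha : a (n + 1) = 0) :
    rotProd g k (n + 1) a (n + 1) = defect (g k (k + n + 1)) * a n := by
  rw [rotProd, rotProd_apply_of_lt g k (Nat.lt_succ_self n), rot, if_neg (by omega), if_pos rfl,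
    ha]
  ring

/-- The last coordinate is the product of the defects d_{i,k+n} with k ≤ i < k+n. -/
theorem latticeU_last_ne_zero {g : ℕ → ℕ → ℂ} (hg : ∀ k j, k < j → ‖g k j‖ < 1) (k n : ℕ) :
    latticeU g k n (Pi.single 0 1) n ≠ 0 := by
  induction n generalizing k with
  | zero => simp [latticeU]
  | succ n ih =>
    rw [latticeU, rotProd_last g k n (latticeU_apply_of_lt g _ (Nat.lt_succ_self n))]
    exact mul_ne_zero (defect_pos (hg _ _ (by omega))).ne' (ih _)

theorem rotProd_congr {g g' : ℕ → ℕ → ℂ} {k n : ℕ}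
    (h : ∀ i < n, g k (k + i + 1) = g' k (k + i + 1)) (a : ℕ → ℂ) :
    rotProd g k n a = rotProd g' k n a := by
  induction n generalizing a with
  | zero => rfl
  | succ n ih => rw [rotProd, rotProd, h n (by omega), ih (fun i hi => h i (by omega))]

theorem latticeU_congr {g g' : ℕ → ℕ → ℂ} {k n : ℕ}
    (h : ∀ i j, i < j → j ≤ i + n → g i j = g' i j) (a : ℕ → ℂ) :
    latticeU g k n a = latticeU g' k n a := by
  induction n generalizing k a with
  | zero => rfl
  | succ n ih =>
    rw [latticeU, latticeU, ih (fun i j h1 h2 => h i j h1 (by omega))]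
    exact rotProd_congr (fun i hi => h _ _ (by omega) (by omega)) _

/-- Two vectors which differ only in the `n`-th coordinate have different images. -/
theorem rotProd_apply_zero_injective {g : ℕ → ℕ → ℂ} (hg : ∀ k j, k < j → ‖g k j‖ < 1)
    (k n : ℕ) {a b : ℕ → ℂ} (hab : ∀ i < n, a i = b i)
    (h : rotProd g k n a 0 = rotProd g k n b 0) : a n = b n := by
  induction n generalizing a b with
  | zero => exact h
  | succ n ih =>
    rw [rotProd, rotProd] at h
    have := ih (a := rot (g k (k + n + 1)) n a) (b := rot (g k (k + n + 1)) n b)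
      (fun i hi => by simp only [rot, if_neg (show i ≠ n by omega),
        if_neg (show i ≠ n + 1 by omega), hab i (by omega)]) h
    simp only [rot, if_true, hab n (by omega), add_right_inj] at this
    exact mul_left_cancel₀ (defect_pos (hg _ _ (by omega))).ne' this

/-- A kernel with non-vanishing diagonal has at most one family of parameters. -/
theorem IsParamFamily.unique {K : Matrix ℕ ℕ ℂ} (hK : ∀ k, 0 < (K k k).re) {g g' : ℕ → ℕ → ℂ}
    (hg : IsParamFamily K g) (hg' : IsParamFamily K g') : g = g' := by
  -- Induction on the distance of the indices: besides parameters at smaller distance, the entry of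
  -- `K` at distance n+1 involves only the parameter with the same indices, and depends on it
  -- injectively.
  have key : ∀ n i j, i < j → j ≤ i + n → g i j = g' i j := by
    intro n
    induction n with
    | zero => intro i j h1 h2; omega
    | succ n ih =>
      intro k j h1 h2
      rcases h2.lt_or_eq with h2 | rfl
      · exact ih k j h1 (by omega)
      have e := (hg.2.2 k (n + 1)).symm.trans (hg'.2.2 k (n + 1))
      have p1 : ((Real.sqrt (K k k).re : ℝ) : ℂ) ≠ 0 := by
        exact_mod_cast (Real.sqrt_pos.2 (hK _)).ne'
      have p2 : ((Real.sqrt (K (k + (n + 1)) (k + (n + 1))).re : ℝ) : ℂ) ≠ 0 := by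
        exact_mod_cast (Real.sqrt_pos.2 (hK _)).ne'
      have e := mul_left_cancel₀ p1 (mul_right_cancel₀ p2 e)
      rw [latticeU, latticeU, latticeU_congr (g := g) (g' := g') ih, rotProd, rotProd,
        rotProd_congr (g := g) (g' := g') fun i hi => ih _ _ (by omega) (by omega)] at e
      -- Since coordinate n+1 vanishes before the last rotation, coordinate n afterwards is the
      -- unknown parameter times the nonzero number in `hl`.
      have hz := latticeU_apply_of_lt g' (k + 1) (Nat.lt_succ_self n)
      have hl := latticeU_last_ne_zero hg'.2.1 (k + 1) n
      have := rotProd_apply_zero_injective hg'.2.1 k n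
        (fun i hi => by simp only [rot, if_neg (show i ≠ n by omega),
          if_neg (show i ≠ n + 1 by omega)]) e
      simp only [rot, if_true, hz, mul_zero, add_zero] at this
      exact mul_right_cancel₀ hl this
  funext k j
  rcases lt_or_ge k j with h | h
  · exact key j k j h (by omega)
  · rw [hg.1 k j h, hg'.1 k j h]

section

variable {E : Type*} [NormedAddCommGroup E] [InnerProductSpace ℂ E]

/-- The family of the numbers `refl v k n`, indexed by `k` and `k + n + 1`. -/
noncomputable def reflFamily (v : ℕ → E) (k j : ℕ) : ℂ := if k < j then refl v k (j - k - 1) else 0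

theorem reflFamily_add (v : ℕ → E) (k n : ℕ) : reflFamily v k (k + n + 1) = refl v k n := by
  rw [reflFamily, if_pos (by omega), show k + n + 1 - k - 1 = n by omega]

/-- Each rotation is a change of basis: by the two rotation formulas it turns coordinates with
respect to `fwd v (k+1) n`, `bwd v k (n+1)` into coordinates with respect to `bwd v k n`, `fwd v k
(n+1)`. -/
theorem sum_rotProd_smul_fwd (v : Module.Basis ℕ ℂ E) (k n : ℕ) (a : ℕ → ℂ) :
    ∑ i ∈ Finset.range (n + 1), rotProd (reflFamily v) k n a i • fwd v k i =
      ∑ i ∈ Finset.range n, a i • fwd v (k + 1) i + a n • bwd v k n := by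
  induction n generalizing a with
  | zero => simp [rotProd, fwd_zero, bwd_zero]
  | succ n ih =>
    rw [Finset.sum_range_succ, rotProd, ih, rotProd_apply_of_lt _ _ (Nat.lt_succ_self n),
      reflFamily_add, Finset.sum_range_succ _ n]
    have h1 : ∑ i ∈ Finset.range n, rot (refl v k n) n a i • fwd v (k + 1) i
        = ∑ i ∈ Finset.range n, a i • fwd v (k + 1) i := by
      apply Finset.sum_congr rfl
      intro i hi
      have := Finset.mem_range.1 hi
      rw [rot, if_neg (by omega), if_neg (by omega)]
    rw [h1, fwd_succ_left v, bwd_succ_eq v]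
    simp only [rot, if_true, if_neg (show n + 1 ≠ n by omega)]
    module

/-- Iterating the changes of basis, the first column of U_{k,k+n} lists the coordinates of the
normalized `v (k+n)` in the forward vectors starting at `k`. Its entry 0 is the normalized kernel
entry. -/
theorem sum_latticeU_smul_fwd (v : Module.Basis ℕ ℂ E) (k n : ℕ) :
    ∑ i ∈ Finset.range (n + 1), latticeU (reflFamily v) k n (Pi.single 0 1) i • fwd v k i =
      fwd v (k + n) 0 := by
  induction n generalizing k with
  | zero => simp [latticeU]
  | succ n ih =>
    rw [latticeU, sum_rotProd_smul_fwd, ih, latticeU_apply_of_lt _ _ (Nat.lt_succ_self n),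
      show k + 1 + n = k + (n + 1) by omega]
    simp

theorem isParamFamily_reflFamily (v : Module.Basis ℕ ℂ E) :
    IsParamFamily (fun k j => inner ℂ (v k) (v j)) (reflFamily v) := by
  refine ⟨fun k j h => if_neg (by omega), ?_, ?_⟩
  · intro k j h
    rw [reflFamily, if_pos h]
    exact norm_refl_lt_one v k _
  · intro k n
    have hs : ∀ j, Real.sqrt (inner ℂ (v j) (v j)).re = ‖v j‖ := by
      intro j
      exact (norm_eq_sqrt_re_inner (𝕜 := ℂ) (v j)).symm
    have hv : ∀ j, v j = ((‖v j‖ : ℝ) : ℂ) • fwd v j 0 := by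
      intro j
      have h0 : ‖v j‖ ≠ 0 := norm_ne_zero_iff.2 (v.ne_zero j)
      rw [fwd_zero, smul_smul, ← Complex.ofReal_mul, mul_inv_cancel₀ h0]
      simp
    have h1 : inner ℂ (fwd v k 0) (fwd v (k + n) 0)
        = latticeU (reflFamily v) k n (Pi.single 0 1) 0 := by
      rw [← sum_latticeU_smul_fwd, inner_sum, Finset.sum_eq_single 0]
      · rw [inner_smul_right, inner_self_eq_norm_sq_to_K, (isFwd_fwd v k 0).norm_eq]
        simp
      · intro i _ hi
        rw [inner_smul_right, fwd_zero, inner_smul_left,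
          (isFwd_fwd v k i).inner_eq_zero k le_rfl (by omega)]
        simp
      · simp
    simp only [hs]
    conv_lhs => rw [hv k, hv (k + n)]
    rw [inner_smul_left, inner_smul_right, h1, Complex.conj_ofReal]
    ring

theorem param_eq_reflFamily (v : Module.Basis ℕ ℂ E) :
    param (fun k j => inner ℂ (v k) (v j)) = reflFamily v := by
  refine IsParamFamily.unique (K := fun k j => inner ℂ (v k) (v j)) (fun k => ?_)
    (Classical.epsilon_spec ⟨_, isParamFamily_reflFamily v⟩) (isParamFamily_reflFamily v)
  have h : (inner ℂ (v k) (v k)).re = ‖v k‖ ^ 2 := inner_self_eq_norm_sq (𝕜 := ℂ) (v k)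
  rw [h]
  exact pow_pos (norm_pos_iff.2 (v.ne_zero k)) 2

end

/-! ### Contractions and Gram kernels -/

section Contraction

variable {E H : Type*} [NormedAddCommGroup E] [InnerProductSpace ℂ E] [NormedAddCommGroup H]
  [InnerProductSpace ℂ H]

theorem sum_star_mul_inner_mul (a : ℕ → E) (x : ℕ →₀ ℂ) :
    (x.sum fun i xi => x.sum fun j xj => star xi * inner ℂ (a i) (a j) * xj) =
      ((‖Finsupp.linearCombination ℂ a x‖ ^ 2 : ℝ) : ℂ) := by
  have h := inner_self_eq_norm_sq_to_K (𝕜 := ℂ) (Finsupp.linearCombination ℂ a x)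
  push_cast
  refine Eq.trans ?_ h
  rw [Finsupp.linearCombination_apply]
  simp only [Finsupp.sum]
  rw [sum_inner]
  apply Finset.sum_congr rfl
  intro i _
  rw [inner_sum]
  apply Finset.sum_congr rfl
  intro j _
  rw [inner_smul_left, inner_smul_right, Complex.star_def]
  ring

/-- One Gram kernel is below another if and only if there is a contraction between the vectors. -/
theorem posSemidef_gram_sub_iff (a : ℕ → E) (b : ℕ → H) :
    (Matrix.of (fun k j => inner ℂ (a k) (a j)) -
      Matrix.of fun k j => inner ℂ (b k) (b j)).PosSemidef ↔
      ∀ x : ℕ →₀ ℂ, ‖Finsupp.linearCombination ℂ b x‖ ≤ ‖Finsupp.linearCombination ℂ a x‖ := by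
  have key : ∀ x : ℕ →₀ ℂ, (0 ≤ x.sum fun i xi => x.sum fun j xj =>
      star xi * (Matrix.of (fun k j => inner ℂ (a k) (a j)) -
        Matrix.of fun k j => inner ℂ (b k) (b j)) i j * xj) ↔
      ‖Finsupp.linearCombination ℂ b x‖ ≤ ‖Finsupp.linearCombination ℂ a x‖ := by
    intro x
    have : (x.sum fun i xi => x.sum fun j xj =>
      star xi * (Matrix.of (fun k j => inner ℂ (a k) (a j)) -
        Matrix.of fun k j => inner ℂ (b k) (b j)) i j * xj) = ((‖Finsupp.linearCombination ℂ a x‖ ^ 2 -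
          ‖Finsupp.linearCombination ℂ b x‖ ^ 2 : ℝ) : ℂ) := by
      rw [Complex.ofReal_sub, ← sum_star_mul_inner_mul, ← sum_star_mul_inner_mul,
        ← Finsupp.sum_sub]
      simp only [← Finsupp.sum_sub]
      simp only [Finsupp.sum]
      refine Finset.sum_congr rfl fun i _ => Finset.sum_congr rfl fun j _ => ?_
      rw [← sub_mul, ← mul_sub]
      rfl
    rw [this, Complex.zero_le_real, sub_nonneg]
    exact pow_le_pow_iff_left₀ (norm_nonneg _) (norm_nonneg _) two_ne_zero
  refine ⟨fun h x => (key x).1 (h.2 x), fun h => ⟨?_, fun x => (key x).2 (h x)⟩⟩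
  ext i j
  simp only [Matrix.conjTranspose_apply, Matrix.sub_apply, star_sub]
  congr 1 <;> exact inner_conj_symm _ _

/-- The Cauchy–Schwarz inequality for the defect form of a contraction. -/
theorem norm_inner_sub_inner_sq_le (C : E →ₗ[ℂ] H) (hC : ∀ x, ‖C x‖ ≤ ‖x‖) (x y : E) :
    ‖inner ℂ x y - inner ℂ (C x) (C y)‖ ^ 2 ≤ (‖x‖ ^ 2 - ‖C x‖ ^ 2) * ‖y‖ ^ 2 := by
  let c : PreInnerProductSpace.Core ℂ E :=
    { inner := fun x y => inner ℂ x y - inner ℂ (C x) (C y)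
      conj_inner_symm := fun x y => by
        rw [map_sub, inner_conj_symm, inner_conj_symm]
      re_inner_nonneg := fun x => by
        rw [map_sub, inner_self_eq_norm_sq, inner_self_eq_norm_sq, sub_nonneg]
        exact pow_le_pow_left₀ (norm_nonneg _) (hC x) 2
      add_left := fun x y z => by
        rw [map_add, inner_add_left, inner_add_left]
        ring
      smul_left := fun x y r => by
        rw [map_smul, inner_smul_left, inner_smul_left]
        ring }
  have h := @InnerProductSpace.Core.inner_mul_inner_self_le ℂ E _ _ _ c x y
  have e : ∀ x y : E, @inner ℂ E c.toInner x y = inner ℂ x y - inner ℂ (C x) (C y) :=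
    fun _ _ => rfl
  have h1 : ‖inner ℂ x y - inner ℂ (C x) (C y)‖ * ‖inner ℂ y x - inner ℂ (C y) (C x)‖ ≤
      RCLike.re (inner ℂ x x - inner ℂ (C x) (C x)) *
        RCLike.re (inner ℂ y y - inner ℂ (C y) (C y)) := h
  have h2 : ‖inner ℂ y x - inner ℂ (C y) (C x)‖ = ‖inner ℂ x y - inner ℂ (C x) (C y)‖ := by
    rw [← inner_conj_symm y x, ← inner_conj_symm (C y) (C x), ← map_sub, RCLike.norm_conj]
  rw [h2, map_sub, map_sub, inner_self_eq_norm_sq, inner_self_eq_norm_sq, inner_self_eq_norm_sq,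
    inner_self_eq_norm_sq, ← sq] at h1
  refine h1.trans (mul_le_mul_of_nonneg_left (sub_le_self _ (sq_nonneg _)) (sub_nonneg.2 ?_))
  exact pow_le_pow_left₀ (norm_nonneg _) (hC x) 2

/-- Bessel's inequality for a functional of norm at most one. -/
theorem tendsto_zero_of_orthonormal {f : ℕ → E} (hf : Orthonormal ℂ f) (l : E →ₗ[ℂ] ℂ)
    (hl : ∀ x, ‖l x‖ ≤ ‖x‖) : Tendsto (fun n => l (f n)) atTop (𝓝 0) := by
  have hb : ∀ M, ∑ n ∈ Finset.range M, ‖l (f n)‖ ^ 2 ≤ 1 := by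
    intro M
    set S := ∑ n ∈ Finset.range M, ‖l (f n)‖ ^ 2 with hS
    have hS0 : 0 ≤ S := Finset.sum_nonneg fun _ _ => sq_nonneg _
    -- For this vector l x = S = ‖x‖², so the bound on `l` reads S ≤ √S.
    set x := ∑ n ∈ Finset.range M, star (l (f n)) • f n with hx
    have h1 : l x = (S : ℂ) := by
      rw [hx, map_sum, hS, Complex.ofReal_sum]
      refine Finset.sum_congr rfl fun n _ => ?_
      rw [map_smul, smul_eq_mul, mul_comm, Complex.star_def, Complex.mul_conj,
        Complex.normSq_eq_norm_sq]
    have h2 : ‖x‖ ^ 2 = S := by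
      have h3 := inner_self_eq_norm_sq_to_K (𝕜 := ℂ) x
      rw [hx, hf.inner_sum, ← hx] at h3
      apply Complex.ofReal_injective
      push_cast
      refine h3.symm.trans ?_
      rw [hS, Complex.ofReal_sum]
      refine Finset.sum_congr rfl fun n _ => ?_
      rw [Complex.star_def, Complex.conj_conj, Complex.mul_conj, Complex.normSq_eq_norm_sq]
    have h4 := hl x
    rw [h1, Complex.norm_real, Real.norm_of_nonneg hS0] at h4
    nlinarith [norm_nonneg x]
  have hs : Summable fun n => ‖l (f n)‖ ^ 2 :=
    summable_of_sum_range_le (fun _ => sq_nonneg _) hb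
  have ht := hs.tendsto_atTop_zero
  rw [tendsto_zero_iff_norm_tendsto_zero]
  have := ht.sqrt
  simpa [Real.sqrt_sq] using this

end Contraction

/-! ### The spectral factor -/

section Spectral

variable {F : ℕ → Type} [∀ k, NormedAddCommGroup (F k)] [∀ k, InnerProductSpace ℂ (F k)]

/-- The array with a single non-zero row. -/
noncomputable def rowArray (m : ℕ) (a : ℕ → F m) (ha : ∀ j, m < j → a j = 0) :
    TriArray F where
  entry k j := (lp.single 2 m (a j) : lp F 2) k
  lower k j h := by
    rcases eq_or_ne k m with rfl | hk
    · rw [lp.single_apply_self, ha j h]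
    · rw [lp.single_apply_ne _ _ _ hk]
  memlp j := lp.memℓp _

theorem rowArray_col (m : ℕ) (a : ℕ → F m) (ha : ∀ j, m < j → a j = 0) (j : ℕ) :
    (rowArray m a ha).col j = lp.single 2 m (a j) := rfl

/-- The whole space is the m-th summand, which column m spans; for k > m there is nothing to
approximate. -/
theorem rowArray_isOuter {m : ℕ} {a : ℕ → F m} {ha : ∀ j, m < j → a j = 0}
    (hF : ∀ k, k ≠ m → ∀ y : F k, y = 0) (h1 : ∀ y : F m, y ∈ Submodule.span ℂ {a m}) :
    (rowArray m a ha).IsOuter := by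
  intro k x hx
  apply Submodule.le_topologicalClosure
  obtain ⟨c, hc⟩ := Submodule.mem_span_singleton.1 (h1 (x m))
  have hxe : x = lp.single 2 m (x m) := by
    ext i
    rcases eq_or_ne i m with rfl | hi
    · rw [lp.single_apply_self]
    · rw [hF i hi (x i), hF i hi (lp.single 2 m (x m) i)]
  rcases lt_or_ge m k with h | h
  · rw [hxe, hx m h]
    have : (lp.single 2 m (0 : F m) : lp F 2) = 0 := by
      rw [← norm_eq_zero, lp.norm_single (by norm_num), norm_zero]
    rw [this]
    exact Submodule.zero_mem _
  · rw [hxe, ← hc, lp.single_smul, ← rowArray_col m a ha]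
    exact Submodule.smul_mem _ _ (Submodule.subset_span ⟨m, h, rfl⟩)

end Spectral

/-! ### Arrays as triangular contractions; peak sequences -/

section

variable {E : Type*} [NormedAddCommGroup E] [InnerProductSpace ℂ E]

section

variable {F : ℕ → Type} [∀ k, NormedAddCommGroup (F k)] [∀ k, InnerProductSpace ℂ (F k)]

/-- The linear map which sends the basis vectors to the columns of an array. -/
noncomputable def TriArray.toMap (T : TriArray F) (v : Module.Basis ℕ ℂ E) : E →ₗ[ℂ] lp F 2 :=
  v.constr ℂ T.col

theorem TriArray.toMap_basis (T : TriArray F) (v : Module.Basis ℕ ℂ E) (j : ℕ) :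
    T.toMap v (v j) = T.col j := v.constr_basis ℂ _ j

theorem TriArray.toMap_eq (T : TriArray F) (v : Module.Basis ℕ ℂ E) (x : E) :
    T.toMap v x = Finsupp.linearCombination ℂ T.col (v.repr x) := by
  rw [TriArray.toMap, Module.Basis.constr_apply, Finsupp.linearCombination_apply]

theorem TriArray.toMap_apply (T : TriArray F) (v : Module.Basis ℕ ℂ E) (x : E) (i : ℕ) :
    T.toMap v x i = (v.repr x).sum fun j c => c • T.entry i j := by
  rw [T.toMap_eq, Finsupp.linearCombination_apply, Finsupp.sum, Finsupp.sum, lp.coeFn_sum,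
    Finset.sum_apply]
  rfl

theorem TriArray.norm_toMap_le (T : TriArray F) (v : Module.Basis ℕ ℂ E)
    (h : (Matrix.of (fun k j => inner ℂ (v k) (v j)) - T.toKernel).PosSemidef) (x : E) :
    ‖T.toMap v x‖ ≤ ‖x‖ := by
  have := (posSemidef_gram_sub_iff v T.col).1 h (v.repr x)
  rwa [v.linearCombination_repr, ← T.toMap_eq] at this

end

/-- A sequence of unit vectors that approximates the normalized component of `v m` orthogonal
to all `v i`, `i > m`. -/
structure IsPeakSeq (v : Module.Basis ℕ ℂ E) (m : ℕ) (u : ℕ → E) : Prop where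
  norm_eq : ∀ k, ‖u k‖ = 1
  repr_eq_zero : ∀ k, ∀ i < m, v.repr (u k) i = 0
  repr_pos : ∀ k, 0 < v.repr (u k) m
  inner_mul : ∀ k, v.repr (u k) m * inner ℂ (u k) (v m) = 1
  inner_eq_zero : ∀ i, m < i → ∀ᶠ k in atTop, inner ℂ (u k) (v i) = 0

variable {F : ℕ → Submodule ℂ ℂ} {v : Module.Basis ℕ ℂ E} {T : TriArray fun k => F k}

theorem toMap_apply_eq_mul {m : ℕ} {x : E} (hx : ∀ i < m, v.repr x i = 0) :
    T.toMap v x m = v.repr x m • T.entry m m := by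
  rw [T.toMap_apply, Finsupp.sum_eq_single m]
  · intro i _ hi
    rcases lt_or_gt_of_ne hi with h | h
    · rw [hx i h, zero_smul]
    · rw [T.lower m i h, smul_zero]
  · simp

/-- The easy estimate for the diagonal entries. -/
theorem norm_repr_mul_diag_le {m : ℕ} {x : E} (hx : ∀ i < m, v.repr x i = 0)
    (hT : (Matrix.of (fun k j => inner ℂ (v k) (v j)) - T.toKernel).PosSemidef) :
    ‖v.repr x m * (T.entry m m : ℂ)‖ ≤ ‖x‖ := by
  have h1 := (lp.norm_apply_le_norm (by norm_num) (T.toMap v x) m).trans (T.norm_toMap_le v hT x)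
  rwa [toMap_apply_eq_mul hx] at h1

/-- The diagonal entries of an outer array are distances. -/
theorem le_norm_diag_of_isOuter (hO : T.IsOuter) {m : ℕ} {c : ℝ}
    (hc : ∀ x : ℕ →₀ ℂ, x m = 1 → (∀ i < m, x i = 0) →
      c ≤ ‖Finsupp.linearCombination ℂ T.col x‖) : c ≤ ‖(T.entry m m : ℂ)‖ := by
  -- The part of column m strictly below the diagonal is, by outerness, a limit of combinations of
  -- later columns; subtracting it leaves exactly the diagonal entry.
  set y : lp (fun k => F k) 2 := T.col m - lp.single 2 m (T.entry m m) with hy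
  have hmem : y ∈ (Submodule.span ℂ (T.col '' Set.Ici (m + 1))).topologicalClosure := by
    apply hO
    intro i hi
    rcases (Nat.lt_succ_iff.1 hi).eq_or_lt with rfl | h
    · rw [hy, lp.coeFn_sub, Pi.sub_apply, lp.single_apply_self]
      exact sub_self _
    · rw [hy, lp.coeFn_sub, Pi.sub_apply, lp.single_apply_ne _ _ _ h.ne]
      rw [show T.col m i = T.entry i m from rfl, T.lower i m h, sub_zero]
  have hcl : IsClosed {z : lp (fun k => F k) 2 | c ≤ ‖T.col m - z‖} :=
    isClosed_le continuous_const (continuous_const.sub continuous_id).norm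
  have hsub : (Submodule.span ℂ (T.col '' Set.Ici (m + 1)) : Set (lp (fun k => F k) 2)) ⊆
      {z | c ≤ ‖T.col m - z‖} := by
    intro z hz
    obtain ⟨x, hx, rfl⟩ := (Finsupp.mem_span_image_iff_linearCombination ℂ).1 hz
    have hx0 : ∀ i ≤ m, x i = 0 := by
      intro i hi
      by_contra h
      have := (Finsupp.mem_supported ℂ x).1 hx (Finsupp.mem_support_iff.2 h)
      have := Set.mem_Ici.1 this
      omega
    have := hc (Finsupp.single m 1 - x) (by simp [hx0 m le_rfl]) (fun i hi => by
      simp [hx0 i hi.le, Finsupp.single_eq_of_ne hi.ne])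
    simpa using this
  have h1 : c ≤ ‖T.col m - y‖ := closure_minimal hsub hcl hmem
  rw [hy, sub_sub_cancel, lp.norm_single (by norm_num)] at h1
  exact h1

theorem IsPeakSeq.norm_inner_eq {m : ℕ} {u : ℕ → E} (hu : IsPeakSeq v m u) (k : ℕ) :
    ‖inner ℂ (u k) (v m)‖ = ‖v.repr (u k) m‖⁻¹ := by
  have := congrArg norm (hu.inner_mul k)
  rw [norm_mul, norm_one] at this
  exact eq_inv_of_mul_eq_one_right this

/-- The maximality of a spectral factor determines its diagonal entries. -/
theorem IsPeakSeq.tendsto_ultrafilter {m : ℕ} {u : ℕ → E} (hu : IsPeakSeq v m u)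
    {c : ℝ} (hc0 : 0 < c) (hc : ∀ k, ‖v.repr (u k) m‖ * c ≤ 1)
    (h0 : 0 ≤ (T.entry m m : ℂ)) (hO : T.IsOuter)
    (hT : (Matrix.of (fun k j => inner ℂ (v k) (v j)) - T.toKernel).PosSemidef)
    (hmax : ∀ (F' : ℕ → Type) [∀ k, NormedAddCommGroup (F' k)]
      [∀ k, InnerProductSpace ℂ (F' k)] [∀ k, CompleteSpace (F' k)] (T' : TriArray F'),
      T'.IsOuter → (Matrix.of (fun k j => inner ℂ (v k) (v j)) - T'.toKernel).PosSemidef →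
      (T.toKernel - T'.toKernel).PosSemidef)
    (U : Ultrafilter ℕ) (hU : (U : Filter ℕ) ≤ atTop) :
    Tendsto (fun k => v.repr (u k) m * (T.entry m m : ℂ)) U (𝓝 1) := by
  -- Along an ultrafilter all these bounded sequences converge at once; this replaces a weak limit
  -- in the completion.
  have hlim : ∀ j, ∃ t : ℂ, Tendsto (fun k => inner ℂ (u k) (v j)) U (𝓝 t) := by
    intro j
    obtain ⟨t, -, ht⟩ := (isCompact_closedBall (0 : ℂ) ‖v j‖).ultrafilter_le_nhds
      (U.map fun k => inner ℂ (u k) (v j)) (tendsto_principal.2 (.of_forall fun k => by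
        rw [mem_closedBall_zero_iff]
        have := norm_inner_le_norm (𝕜 := ℂ) (u k) (v j)
        rwa [hu.norm_eq, one_mul] at this))
    exact ⟨t, ht⟩
  choose t ht using hlim
  have ht0 : ∀ j, m < j → t j = 0 := by
    intro j hj
    refine tendsto_nhds_unique (ht j) (tendsto_const_nhds.congr' ?_)
    filter_upwards [hU (hu.inner_eq_zero j hj)] with k hk using hk.symm
  -- The pairing of `u k` with `v m` is the reciprocal of the leading coefficient; the bound `c`
  -- keeps it away from 0.
  have htm : c ≤ ‖t m‖ := by
    refine ge_of_tendsto (ht m).norm (Filter.Eventually.of_forall fun k => ?_)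
    have hp : 0 < ‖v.repr (u k) m‖ := norm_pos_iff.2 (hu.repr_pos k).ne'
    rw [hu.norm_inner_eq, ← one_div, le_div_iff₀ hp, mul_comm]
    exact hc k
  have htm0 : t m ≠ 0 := norm_pos_iff.1 (hc0.trans_le htm)
  have hbound : ∀ x : ℕ →₀ ℂ, ‖x.sum fun j c => c * t j‖ ≤ ‖Finsupp.linearCombination ℂ v x‖ := by
    intro x
    have h1 : Tendsto (fun k => inner ℂ (u k) (Finsupp.linearCombination ℂ v x)) U
        (𝓝 (x.sum fun j c => c * t j)) := by
      simp only [Finsupp.linearCombination_apply, Finsupp.sum, inner_sum, inner_smul_right]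
      exact tendsto_finsetSum _ fun j _ => (ht j).const_mul _
    refine le_of_tendsto h1.norm (Filter.Eventually.of_forall fun k => ?_)
    have := norm_inner_le_norm (𝕜 := ℂ) (u k) (Finsupp.linearCombination ℂ v x)
    rwa [hu.norm_eq, one_mul] at this
  let F' : ℕ → Submodule ℂ ℂ := fun k => if k = m then ⊤ else ⊥
  have hF' : F' m = ⊤ := if_pos rfl
  let a : ℕ → F' m := fun j => ⟨t j, by rw [hF']; trivial⟩
  have ha : ∀ j, m < j → a j = 0 := fun j hj => Subtype.ext (ht0 j hj)
  let T' : TriArray fun k => F' k := rowArray (F := fun k => F' k) m a ha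
  have hT'n : ∀ x : ℕ →₀ ℂ,
      ‖Finsupp.linearCombination ℂ T'.col x‖ = ‖x.sum fun j c => c * t j‖ := by
    intro x
    have h1 : Finsupp.linearCombination ℂ T'.col x =
        lp.single (E := fun k => F' k) 2 m (x.sum fun j c => c • a j) := by
      rw [Finsupp.linearCombination_apply, Finsupp.sum, Finsupp.sum,
        ← lp.singleAddMonoidHom_apply, map_sum]
      refine Finset.sum_congr rfl fun j _ => ?_
      rw [lp.singleAddMonoidHom_apply, lp.single_smul]
      rfl
    rw [h1, lp.norm_single (by norm_num), ← Submodule.norm_coe]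
    congr 1
    rw [Finsupp.sum, Finsupp.sum, Submodule.coe_sum]
    rfl
  have hT'O : T'.IsOuter := by
    refine rowArray_isOuter (F := fun k => F' k) ?_ ?_
    · intro k hk y
      exact Subtype.ext ((Submodule.mem_bot ℂ).1 ((show F' k = ⊥ from if_neg hk).le y.2))
    · intro y
      refine Submodule.mem_span_singleton.2 ⟨(y : ℂ) / t m, Subtype.ext ?_⟩
      exact div_mul_cancel₀ _ htm0
  have hle := hmax (fun k => F' k) T' hT'O
    ((posSemidef_gram_sub_iff v T'.col).2 fun x => by rw [hT'n]; exact hbound x)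
  have hle2 := (posSemidef_gram_sub_iff T.col T'.col).1 hle
  -- Maximality enters here: a combination with coefficient 1 at m and none before has image of norm
  -- ‖t m‖ under the row `t`, hence at least that norm under `T`.
  have hd1 : ‖t m‖ ≤ ‖(T.entry m m : ℂ)‖ := by
    refine le_norm_diag_of_isOuter hO fun x hx hx0 => ?_
    have := hle2 x
    rwa [hT'n, Finsupp.sum_eq_single m, hx, one_mul] at this
    · intro i _ hi
      rcases lt_or_gt_of_ne hi with h | h
      · rw [hx0 i h, zero_mul]
      · rw [ht0 i h, mul_zero]
    · simp
  have hd2 : ‖(T.entry m m : ℂ)‖ ≤ ‖t m‖ := by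
    refine ge_of_tendsto (ht m).norm (Filter.Eventually.of_forall fun k => ?_)
    have hp : 0 < ‖v.repr (u k) m‖ := norm_pos_iff.2 (hu.repr_pos k).ne'
    rw [hu.norm_inner_eq, ← one_div, le_div_iff₀ hp, mul_comm, ← norm_mul, ← hu.norm_eq k]
    exact norm_repr_mul_diag_le (hu.repr_eq_zero k) hT
  have hd : ‖t m‖ = ‖(T.entry m m : ℂ)‖ := le_antisymm hd1 hd2
  have h1 : Tendsto (fun k => ‖inner ℂ (u k) (v m)‖⁻¹ * ‖(T.entry m m : ℂ)‖) U (𝓝 1) := by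
    have h2 := ((ht m).norm.inv₀ (norm_ne_zero_iff.2 htm0)).mul_const ‖t m‖
    rwa [inv_mul_cancel₀ (norm_ne_zero_iff.2 htm0), hd] at h2
  have h3 := (Complex.continuous_ofReal.tendsto _).comp h1
  rw [Complex.ofReal_one] at h3
  refine h3.congr fun k => ?_
  rw [Function.comp_apply, hu.norm_inner_eq, inv_inv, Complex.ofReal_mul,
    ← Complex.eq_coe_norm_of_nonneg h0, ← Complex.eq_coe_norm_of_nonneg (hu.repr_pos k).le]

/-- Along a sequence which peaks at `m` the images under the contraction converge to the `m`-th
coordinate vector. -/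
theorem IsPeakSeq.tendsto_of_diag {m : ℕ} {u : ℕ → E} (hu : IsPeakSeq v m u)
    (hT : (Matrix.of (fun k j => inner ℂ (v k) (v j)) - T.toKernel).PosSemidef)
    (hd : Tendsto (fun k => v.repr (u k) m * (T.entry m m : ℂ)) atTop (𝓝 1)) :
    (∀ j, Tendsto (fun k => inner ℂ (u k) (v j)) atTop (𝓝 (T.entry m j : ℂ))) ∧
    ∀ i, Tendsto (fun k => (T.toMap v (u k) i : ℂ)) atTop (𝓝 (if i = m then 1 else 0)) := by
  have hm0 : (T.entry m m : ℂ) ≠ 0 := by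
    intro h
    rw [h] at hd
    simp only [mul_zero] at hd
    exact zero_ne_one (tendsto_nhds_unique tendsto_const_nhds hd)
  let e : F m := (T.entry m m : ℂ)⁻¹ • T.entry m m
  have he : (e : ℂ) = 1 := inv_mul_cancel₀ hm0
  let s : lp (fun k => F k) 2 := lp.single 2 m e
  have hs : ‖s‖ = 1 := by
    rw [lp.norm_single (by norm_num), ← Submodule.norm_coe, he, norm_one]
  set C := T.toMap v with hC
  have hCm : ∀ k, (C (u k) m : ℂ) = v.repr (u k) m * (T.entry m m : ℂ) := by
    intro k
    rw [hC, toMap_apply_eq_mul (hu.repr_eq_zero k)]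
    rfl
  have hCle : ∀ k, ‖C (u k)‖ ≤ 1 := fun k => by
    rw [← hu.norm_eq k]
    exact T.norm_toMap_le v hT _
  have hin : ∀ y : lp (fun k => F k) 2, inner ℂ s y = (y m : ℂ) := by
    intro y
    rw [lp.inner_single_left, Submodule.coe_inner, he]
    simp
  -- Vectors of the unit ball whose component along the unit vector `s` tends to 1 converge to `s`,
  -- as ‖C u - s‖² ≤ 2 - 2 Re ⟨s, C u⟩.
  have hnorm : Tendsto (fun k => C (u k)) atTop (𝓝 s) := by
    rw [tendsto_iff_norm_sub_tendsto_zero]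
    have h1 : Tendsto (fun k => Real.sqrt (2 - 2 * (C (u k) m : ℂ).re)) atTop (𝓝 0) := by
      have h2 : Tendsto (fun k => (C (u k) m : ℂ).re) atTop (𝓝 1) := by
        simp only [hCm]
        exact (Complex.continuous_re.tendsto 1).comp hd
      have h3 := ((h2.const_mul 2).const_sub 2).sqrt
      simpa using h3
    refine squeeze_zero (fun _ => norm_nonneg _) (fun k => ?_) h1
    apply Real.le_sqrt_of_sq_le
    have h4 := norm_sub_rev (C (u k)) s
    rw [h4, norm_sub_sq (𝕜 := ℂ), hs, hin]
    have h5 := pow_le_pow_left₀ (norm_nonneg _) (hCle k) 2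
    have h6 : RCLike.re (C (u k) m : ℂ) = (C (u k) m : ℂ).re := rfl
    rw [h6]
    linarith
  constructor
  · intro j
    have h1 : Tendsto (fun k => inner ℂ (C (u k)) (C (v j))) atTop (𝓝 (T.entry m j : ℂ)) := by
      have h2 : Tendsto (fun k => inner ℂ (C (u k)) (C (v j))) atTop (𝓝 (inner ℂ s (C (v j)))) :=
        hnorm.inner tendsto_const_nhds
      have h3 : (C (v j) m : ℂ) = T.entry m j := by
        rw [hC, T.toMap_basis]
        rfl
      rwa [hin, h3] at h2
    -- Asymptotically `C` loses no norm on `u k`, so by Cauchy–Schwarz for the defect form it also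
    -- preserves the pairing with a fixed vector.
    have h3 : Tendsto (fun k => inner ℂ (u k) (v j) - inner ℂ (C (u k)) (C (v j)))
        atTop (𝓝 0) := by
      rw [tendsto_zero_iff_norm_tendsto_zero]
      have h4 : Tendsto (fun k => Real.sqrt ((1 - ‖C (u k)‖ ^ 2) * ‖v j‖ ^ 2)) atTop (𝓝 0) := by
        have h5 := (((hnorm.norm.pow 2).const_sub 1).mul_const (‖v j‖ ^ 2)).sqrt
        simpa [hs] using h5
      refine squeeze_zero (fun _ => norm_nonneg _) (fun k => ?_) h4
      apply Real.le_sqrt_of_sq_le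
      have := norm_inner_sub_inner_sq_le C (T.norm_toMap_le v hT) (u k) (v j)
      rwa [hu.norm_eq, one_pow] at this
    simpa using h3.add h1
  · intro i
    have h1 : (if i = m then 1 else 0 : ℂ) = (s i : ℂ) := by
      split_ifs with h
      · subst h
        rw [lp.single_apply_self, he]
      · rw [lp.single_apply_ne _ _ _ h]
        rfl
    rw [h1, tendsto_iff_norm_sub_tendsto_zero]
    refine squeeze_zero (fun _ => norm_nonneg _) (fun k => ?_)
      (tendsto_iff_norm_sub_tendsto_zero.1 hnorm)
    exact lp.norm_apply_le_norm (by norm_num) (C (u k) - s) i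

/-- The entries of every spectral factor are limits along peaking sequences. -/
theorem IsSpectralFactor.tendsto {Θ Θ₀ : Matrix ℕ ℕ ℂ}
    (hΘ : IsSpectralFactor (Matrix.of fun k j => inner ℂ (v k) (v j)) Θ)
    (hΘ₀ : IsSpectralFactor (Matrix.of fun k j => inner ℂ (v k) (v j)) Θ₀)
    {m : ℕ} (hpos : 0 < Θ₀ m m) {u : ℕ → E} (hu : IsPeakSeq v m u) :
    (∀ j, Tendsto (fun k => inner ℂ (u k) (v j)) atTop (𝓝 (Θ m j))) ∧
    ∀ i, Tendsto (fun k => (v.repr (u k)).sum fun j c => c * Θ i j) atTop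
      (𝓝 (if i = m then 1 else 0)) := by
  obtain ⟨F, T, hTe, h0, hO, hT, hmax⟩ := hΘ
  obtain ⟨F₀, T₀, hTe₀, -, -, hT₀, -⟩ := hΘ₀
  -- Positivity is known for `Θ₀` only; it bounds the leading coefficients, and this is what the
  -- argument for an arbitrary spectral factor `Θ` needs.
  have hc : ∀ k, ‖v.repr (u k) m‖ * ‖Θ₀ m m‖ ≤ 1 := by
    intro k
    rw [← norm_mul, hTe₀, ← hu.norm_eq k]
    exact norm_repr_mul_diag_le (hu.repr_eq_zero k) hT₀
  have hd : Tendsto (fun k => v.repr (u k) m * (T.entry m m : ℂ)) atTop (𝓝 1) := by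
    rw [tendsto_iff_ultrafilter]
    intro U hU
    exact hu.tendsto_ultrafilter (norm_pos_iff.2 hpos.ne') hc (hTe m m ▸ h0 m) hO hT hmax U hU
  obtain ⟨h1, h2⟩ := hu.tendsto_of_diag hT hd
  refine ⟨fun j => by rw [hTe]; exact h1 j, fun i => (h2 i).congr fun k => ?_⟩
  rw [T.toMap_apply, Finsupp.sum, Finsupp.sum, Submodule.coe_sum]
  simp only [hTe]
  rfl

/-- The forward vectors `fwd v 0 n` are orthonormal. -/
theorem orthonormal_fwd (v : Module.Basis ℕ ℂ E) : Orthonormal ℂ fun n => fwd v 0 n := by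
  have key : ∀ i j, i < j → inner ℂ (fwd v 0 i) (fwd v 0 j) = 0 := by
    intro i j hij
    have hi := isFwd_fwd v 0 i
    have hj := isFwd_fwd v 0 j
    rw [inner_eq_repr_mul v j, hi.repr_eq_zero j (by omega)]
    · simp
    · intro l hl
      rcases lt_or_gt_of_ne hl with h | h
      · exact Or.inr (hj.inner_eq_zero l (by omega) (by omega))
      · exact Or.inl (hi.repr_eq_zero l (by omega))
  refine ⟨fun n => (isFwd_fwd v 0 n).norm_eq, fun i j hij => ?_⟩
  rcases lt_or_gt_of_ne hij with h | h
  · exact key i j h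
  · exact inner_eq_zero_symm.1 (key j i h)

/-- In the Szegő class the coefficients of the orthonormal vectors tend to zero. -/
theorem IsSpectralFactor.tendsto_repr_fwd {Θ : Matrix ℕ ℕ ℂ}
    (hΘ : IsSpectralFactor (Matrix.of fun k j => inner ℂ (v k) (v j)) Θ)
    (hpos : ∀ m, 0 < Θ m m) (m : ℕ) :
    Tendsto (fun n => v.repr (fwd v 0 n) m) atTop (𝓝 0) := by
  obtain ⟨F, T, hTe, -, -, hT, -⟩ := hΘ
  have hm0 : ∀ m, (T.entry m m : ℂ) ≠ 0 := fun m => by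
    rw [← hTe]
    exact (hpos m).ne'
  have h1 : ∀ m, Tendsto (fun n => (T.toMap v (fwd v 0 n) m : ℂ)) atTop (𝓝 0) := by
    intro m
    refine tendsto_zero_of_orthonormal (orthonormal_fwd v)
      ⟨⟨fun x => (T.toMap v x m : ℂ), fun x y => ?_⟩, fun c x => ?_⟩ fun x => ?_
    · rw [map_add]
      rfl
    · simp only [map_smul]
      rfl
    · exact (lp.norm_apply_le_norm (by norm_num) (T.toMap v x) m).trans (T.norm_toMap_le v hT x)
  have h2 : ∀ m, ∀ x : E, (T.toMap v x m : ℂ) =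
      ∑ j ∈ Finset.range (m + 1), v.repr x j * (T.entry m j : ℂ) := by
    intro m x
    rw [T.toMap_apply, Finsupp.sum, Submodule.coe_sum]
    simp only [Submodule.coe_smul, smul_eq_mul]
    apply Finset.sum_congr_of_eq_on_inter
    · intro j _ hj
      rw [T.lower m j (by simpa using hj)]
      simp
    · intro j _ hj
      rw [Finsupp.notMem_support_iff.1 hj, zero_mul]
    · intros
      rfl
  -- Forward substitution in the triangular system `h2`, whose left-hand sides tend to 0.
  induction m using Nat.strong_induction_on with
  | _ m ih =>
    have h3 : Tendsto (fun n => ((T.toMap v (fwd v 0 n) m : ℂ) -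
        ∑ j ∈ Finset.range m, v.repr (fwd v 0 n) j * (T.entry m j : ℂ)) / (T.entry m m : ℂ))
        atTop (𝓝 ((0 - ∑ j ∈ Finset.range m, 0 * (T.entry m j : ℂ)) / (T.entry m m : ℂ))) :=
      ((h1 m).sub (tendsto_finsetSum _ fun j hj =>
        (ih j (Finset.mem_range.1 hj)).mul_const _)).div_const _
    simp only [zero_mul, Finset.sum_const_zero, sub_zero, zero_div] at h3
    refine h3.congr fun n => ?_
    rw [h2, Finset.sum_range_succ, add_sub_cancel_left, mul_div_cancel_right₀ _ (hm0 m)]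

end

/-! ### The order of the words -/

section Words

variable {N : ℕ} [NeZero N]

theorem shortlex_iff_wordIndex_lt {a b : Word N} :
    List.Shortlex (· < ·) a.toList b.toList ↔ wordIndex a < wordIndex b := by
  have key : ∀ {a b : Word N}, wordIndex a < wordIndex b →
      List.Shortlex (· < ·) a.toList b.toList := by
    intro a b h
    have := shortlex_wordAt (N := N) h
    rwa [wordAt_wordIndex, wordAt_wordIndex] at this
  refine ⟨fun h => ?_, key⟩
  rcases lt_trichotomy (wordIndex a) (wordIndex b) with h1 | h1 | h1
  · exact h1
  · have h2 : a = b := by rw [← wordAt_wordIndex a, h1, wordAt_wordIndex]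
    subst h2
    exact absurd h (by simp [List.shortlex_def, List.lex_irrefl])
  · exfalso
    have h2 := key h1
    rw [List.shortlex_def] at h h2
    rcases h with h | ⟨h, h'⟩ <;> rcases h2 with h2 | ⟨h2, h2'⟩
    · omega
    · omega
    · omega
    · exact List.lex_asymm (fun h1 h2 => lt_asymm h1 h2) h' h2'

/-- Compatibility of the order with left multiplication makes Gram–Schmidt and stationarity fit
together. -/
theorem wordIndex_of_mul_lt_iff (k : Fin N) {a b : Word N} :
    wordIndex (FreeMonoid.of k * a) < wordIndex (FreeMonoid.of k * b) ↔
      wordIndex a < wordIndex b := by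
  rw [← shortlex_iff_wordIndex_lt, ← shortlex_iff_wordIndex_lt, FreeMonoid.toList_of_mul,
    FreeMonoid.toList_of_mul, List.shortlex_cons_iff]

/-- The enumeration of the words as an equivalence. -/
def wordEquiv (N : ℕ) [NeZero N] : Word N ≃ ℕ where
  toFun := wordIndex
  invFun := wordAt N
  left_inv := wordAt_wordIndex
  right_inv := wordIndex_wordAt

theorem wordIndex_injective : Function.Injective (wordIndex (N := N)) := (wordEquiv N).injective

theorem wordIndex_one {N : ℕ} : wordIndex (1 : Word N) = 0 := rfl

theorem wordIndex_pos_of_mul (k : Fin N) (w : Word N) : 0 < wordIndex (FreeMonoid.of k * w) := by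
  rw [← wordIndex_one (N := N), ← shortlex_iff_wordIndex_lt]
  apply List.Shortlex.of_length_lt
  simp

theorem wordIndex_mul_lt_iff (s : Word N) {a b : Word N} :
    wordIndex (s * a) < wordIndex (s * b) ↔ wordIndex a < wordIndex b := by
  induction s using FreeMonoid.inductionOn' with
  | one => rw [one_mul, one_mul]
  | of_mul k s ih => rw [mul_assoc, mul_assoc, wordIndex_of_mul_lt_iff, ih]

/-- The basis of the monomials. -/
noncomputable def monoBasis (N : ℕ) [NeZero N] : Module.Basis ℕ ℂ (PolyN N) :=
  (Module.Basis.ofRepr (MonoidAlgebra.coeffLinearEquiv ℂ)).reindex (wordEquiv N)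

theorem monoBasis_apply (n : ℕ) : monoBasis N n = mono (wordAt N n) := by
  rw [monoBasis, Module.Basis.reindex_apply]
  rfl

theorem monoBasis_repr (P : PolyN N) (n : ℕ) :
    (monoBasis N).repr P n = P.coeff (wordAt N n) := by
  rw [monoBasis, Module.Basis.repr_reindex_apply]
  rfl

end Words

section Mono

variable {N : ℕ}

theorem mono_of_mul (k : Fin N) (w : Word N) : mono (FreeMonoid.of k * w) = var k * mono w := by
  rw [mono, var, mono, mono, MonoidAlgebra.single_mul_single, mul_one]

theorem coeff_var_mul (k l : Fin N) (P : PolyN N) (w : Word N) :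
    (var k * P).coeff (FreeMonoid.of l * w) = if k = l then P.coeff w else 0 := by
  split_ifs with h
  · subst h
    rw [var, mono, MonoidAlgebra.coeff_single_mul_eq_mul_coeff w, one_mul]
    intro m' _
    exact mul_right_inj _
  · rw [var, mono, MonoidAlgebra.coeff_single_mul_of_forall_mul_ne]
    intro d hd
    have := congrArg FreeMonoid.toList hd
    rw [FreeMonoid.toList_of_mul, FreeMonoid.toList_of_mul] at this
    exact h (List.cons.inj this).1

theorem coeff_var_mul_one (k : Fin N) (P : PolyN N) : (var k * P).coeff 1 = 0 := by
  rw [var, mono, MonoidAlgebra.coeff_single_mul_of_forall_mul_ne]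
  intro d hd
  have := congrArg FreeMonoid.toList hd
  rw [FreeMonoid.toList_of_mul] at this
  exact List.cons_ne_nil _ _ this

end Mono

/-! ### The involution -/

section Involution

variable {N : ℕ}

theorem invol_single (w : FreeMonoid (Fin N ⊕ Fin N)) (c : ℂ) :
    invol (MonoidAlgebra.single w c) = MonoidAlgebra.single (invWord w) (star c) := by
  rw [invol, MonoidAlgebra.coeff_single, Finsupp.sum_single_index]
  simp

theorem invol_add (P Q : Poly2N N) : invol (P + Q) = invol P + invol Q := by
  rw [invol, MonoidAlgebra.coeff_add, Finsupp.sum_add_index']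
  · rfl
  · simp
  · intro w a b
    rw [star_add, MonoidAlgebra.single_add]

theorem invol_zero : invol (0 : Poly2N N) = 0 := by
  simp [invol]

theorem invol_smul (c : ℂ) (P : Poly2N N) : invol (c • P) = star c • invol P := by
  induction P using MonoidAlgebra.induction_linear with
  | zero => rw [smul_zero, invol_zero, smul_zero]
  | add P Q hP hQ => rw [smul_add, invol_add, invol_add, hP, hQ, smul_add]
  | single w a =>
    rw [MonoidAlgebra.smul_single', invol_single, invol_single, MonoidAlgebra.smul_single',
      star_mul']

theorem invWord_mul (u w : FreeMonoid (Fin N ⊕ Fin N)) :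
    invWord (u * w) = invWord w * invWord u := by
  simp [invWord, FreeMonoid.toList_mul, FreeMonoid.ofList_append]

theorem invol_mul (P Q : Poly2N N) : invol (P * Q) = invol Q * invol P := by
  induction P using MonoidAlgebra.induction_linear with
  | zero => rw [zero_mul, invol_zero, mul_zero]
  | add P P' hP hP' => rw [add_mul, invol_add, invol_add, hP, hP', mul_add]
  | single u a =>
    induction Q using MonoidAlgebra.induction_linear with
    | zero => rw [mul_zero, invol_zero, zero_mul]
    | add Q Q' hQ hQ' => rw [mul_add, invol_add, invol_add, hQ, hQ', add_mul]
    | single w b =>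
      rw [MonoidAlgebra.single_mul_single, invol_single, invol_single, invol_single,
        MonoidAlgebra.single_mul_single, invWord_mul, star_mul]

theorem invol_one : invol (1 : Poly2N N) = 1 := by
  rw [MonoidAlgebra.one_def, invol_single, star_one]
  rfl

theorem incl_var (k : Fin N) :
    incl (var k) = MonoidAlgebra.single (FreeMonoid.of (Sum.inl k)) 1 := by
  simp [incl, var, mono]

theorem invol_incl_var (k : Fin N) :
    invol (incl (var k)) = MonoidAlgebra.single (FreeMonoid.of (Sum.inr k)) 1 := by
  rw [incl_var, invol_single, star_one]
  rfl

end Involution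

/-! ### The representation on the full Fock space -/

section Fock

variable {N : ℕ}

/-- The annihilation of the first letter `k`. -/
noncomputable def annihilate (k : Fin N) : PolyN N →ₗ[ℂ] PolyN N :=
  Finsupp.linearCombination ℂ (fun w : Word N =>
    match w.toList with
    | [] => (0 : PolyN N)
    | l :: t => if l = k then mono (FreeMonoid.ofList t) else 0) ∘ₗ
  (MonoidAlgebra.coeffLinearEquiv ℂ).toLinearMap

theorem annihilate_var_mul (k l : Fin N) (P : PolyN N) :
    annihilate k (var l * P) = if l = k then P else 0 := by
  induction P using MonoidAlgebra.induction_linear with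
  | zero => simp
  | add P Q hP hQ => rw [mul_add, map_add, hP, hQ]; split_ifs <;> simp
  | single w a =>
    rw [var, mono, MonoidAlgebra.single_mul_single, one_mul, annihilate]
    simp only [LinearMap.coe_comp, LinearEquiv.coe_coe, Function.comp_apply]
    rw [show (MonoidAlgebra.coeffLinearEquiv ℂ) (MonoidAlgebra.single (FreeMonoid.of l * w) a) =
      Finsupp.single (FreeMonoid.of l * w) a from rfl, Finsupp.linearCombination_single,
      FreeMonoid.toList_of_mul]
    simp only [FreeMonoid.ofList_toList, smul_ite, smul_zero]
    rw [mono, MonoidAlgebra.smul_single', mul_one]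

/-- Creation and annihilation operators. -/
noncomputable def fockRep (N : ℕ) : Poly2N N →ₐ[ℂ] Module.End ℂ (PolyN N) :=
  MonoidAlgebra.lift ℂ _ _ (FreeMonoid.lift
    (Sum.elim (fun k => LinearMap.mulLeft ℂ (var k)) annihilate))

theorem fockRep_incl (P : PolyN N) : fockRep N (incl P) = LinearMap.mulLeft ℂ P := by
  have : (fockRep N).comp incl = Algebra.lmul ℂ (PolyN N) := by
    refine MonoidAlgebra.algHom_ext' (FreeMonoid.hom_eq ?_) (Subsingleton.elim _ _)
    intro k
    simp only [MonoidHom.comp_apply, MonoidAlgebra.of_apply, MonoidHom.coe_coe, AlgHom.comp_apply]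
    rw [show MonoidAlgebra.single (FreeMonoid.of k) (1 : ℂ) = var k from rfl, incl_var, fockRep,
      MonoidAlgebra.lift_single, FreeMonoid.lift_eval_of, one_smul]
    rfl
  exact congrArg (fun f => f P) this

theorem fockRep_invol_incl_var (k : Fin N) : fockRep N (invol (incl (var k))) = annihilate k := by
  rw [invol_incl_var, fockRep, MonoidAlgebra.lift_single, FreeMonoid.lift_eval_of, one_smul]
  rfl

/-- Annihilating the letter k after creating the letter l gives the identity if k = l and 0
otherwise, so the representation descends to the quotient. -/
theorem fockRep_rel {P : Poly2N N} (hP : P ∈ stationaryRel N) : fockRep N P = 0 := by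
  rcases hP with ⟨k, rfl⟩ | ⟨k, l, hkl, rfl⟩
  · rw [map_sub, map_mul, map_one, fockRep_incl, fockRep_invol_incl_var]
    refine LinearMap.ext fun Q => ?_
    rw [LinearMap.sub_apply, Module.End.mul_apply, LinearMap.mulLeft_apply, annihilate_var_mul]
    simp
  · rw [map_mul, fockRep_incl, fockRep_invol_incl_var]
    refine LinearMap.ext fun Q => ?_
    rw [Module.End.mul_apply, LinearMap.mulLeft_apply, annihilate_var_mul, if_neg hkl.symm]
    simp

/-- The polynomials in `X_1, …, X_N` embed into the quotient algebra. -/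
theorem eq_zero_of_proj_incl_eq_zero {P : PolyN N} (h : proj (stationaryRel N) (incl P) = 0) :
    P = 0 := by
  let f := RingQuot.liftAlgHom ℂ (s := fun P Q : Poly2N N => P ∈ stationaryRel N ∧ Q = 0)
    ⟨fockRep N, fun P Q hPQ => by rw [fockRep_rel hPQ.1, hPQ.2, map_zero]⟩
  have h1 : f (proj (stationaryRel N) (incl P)) = fockRep N (incl P) :=
    RingQuot.liftAlgHom_mkAlgHom_apply ..
  rw [h, map_zero, fockRep_incl] at h1
  -- Applied to the vacuum vector 1, multiplication by `P` returns `P`.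
  have := congrArg (fun g => g (1 : PolyN N)) h1
  simpa using this.symm

end Fock

/-! ### The form -/

section Form

variable {N : ℕ} {A : Set (Poly2N N)} (φ : QuotAlg A →ₗ[ℂ] ℂ)

theorem form_add_left (P P' Q : PolyN N) : form φ (P + P') Q = form φ P Q + form φ P' Q := by
  simp only [form, map_add, mul_add]

theorem form_add_right (P Q Q' : PolyN N) : form φ P (Q + Q') = form φ P Q + form φ P Q' := by
  simp only [form, map_add, invol_add, add_mul]

theorem form_smul_left (c : ℂ) (P Q : PolyN N) : form φ (c • P) Q = c * form φ P Q := by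
  simp only [form, map_smul, mul_smul_comm, smul_eq_mul]

theorem form_smul_right (c : ℂ) (P Q : PolyN N) : form φ P (c • Q) = star c * form φ P Q := by
  simp only [form, map_smul, invol_smul, smul_mul_assoc, smul_eq_mul]

/-- Polarization: the values at P + Q and P + iQ are real. -/
theorem star_form (h : ∀ P : PolyN N, 0 ≤ form φ P P) (P Q : PolyN N) :
    star (form φ P Q) = form φ Q P := by
  have him : ∀ P, (form φ P P).im = 0 := fun P => (Complex.nonneg_iff.1 (h P)).2.symm
  have h1 := him (P + Q)
  have h2 := him (P + Complex.I • Q)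
  simp only [form_add_left, form_add_right, form_smul_left, form_smul_right, Complex.add_im,
    Complex.add_re, him, Complex.star_def, Complex.conj_I, Complex.mul_im, Complex.mul_re, Complex.I_re,
    Complex.I_im, Complex.neg_re, Complex.neg_im] at h1 h2
  apply Complex.ext
  · rw [Complex.star_def, Complex.conj_re]
    linarith
  · rw [Complex.star_def, Complex.conj_im]
    linarith

theorem proj_eq_of_rel {P : Poly2N N} (h : P ∈ A) : proj A P = 0 := by
  have := RingQuot.mkAlgHom_rel ℂ (s := fun P Q : Poly2N N => P ∈ A ∧ Q = 0) (x := P) (y := 0)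
    ⟨h, rfl⟩
  rwa [map_zero] at this

/-- Stationarity: in the quotient 𝒥(X_l) X_k collapses to 1 or 0 in the middle of the product. -/
theorem form_var_mul (φ : QuotAlg (stationaryRel N) →ₗ[ℂ] ℂ) (k l : Fin N) (P Q : PolyN N) :
    form φ (var k * P) (var l * Q) = if k = l then form φ P Q else 0 := by
  have h1 : proj (stationaryRel N) (invol (incl (var l)) * incl (var k)) =
      if k = l then 1 else 0 := by
    split_ifs with h
    · subst h
      have : proj (stationaryRel N) (1 - invol (incl (var k)) * incl (var k)) = 0 :=
        proj_eq_of_rel (Or.inl ⟨k, rfl⟩)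
      rw [map_sub, map_one, sub_eq_zero] at this
      exact this.symm
    · exact proj_eq_of_rel (Or.inr ⟨l, k, Ne.symm h, rfl⟩)
  have h2 : invol (incl (var l * Q)) * incl (var k * P) =
      invol (incl Q) * (invol (incl (var l)) * incl (var k)) * incl P := by
    rw [map_mul, map_mul, invol_mul]
    simp only [mul_assoc]
  rw [form, h2, map_mul (proj _), map_mul (proj _), h1]
  split_ifs with h
  · rw [mul_one, ← map_mul (proj _), form]
  · rw [mul_zero, zero_mul, map_zero]

theorem form_one_one : form φ (1 : PolyN N) 1 = φ 1 := by
  rw [form, map_one, invol_one, mul_one, map_one]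

/-- The inner product defined by a strictly positive functional. -/
@[reducible] noncomputable def formCore (φ : QuotAlg (stationaryRel N) →ₗ[ℂ] ℂ)
    (hpos : StrictlyPositive φ) : InnerProductSpace.Core ℂ (PolyN N) :=
  have h0 : ∀ P : PolyN N, P ≠ 0 → 0 < form φ P P := fun P hP =>
    hpos P fun h => hP (eq_zero_of_proj_incl_eq_zero h)
  have h1 : ∀ P : PolyN N, 0 ≤ form φ P P := fun P => by
    rcases eq_or_ne P 0 with rfl | hP
    · simp [form]
    · exact (h0 P hP).le
  { inner := fun P Q => form φ Q P
    conj_inner_symm := fun P Q => star_form φ h1 P Q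
    re_inner_nonneg := fun P => (Complex.nonneg_iff.1 (h1 P)).1
    add_left := fun P P' Q => form_add_right φ Q P P'
    smul_left := fun P Q c => form_smul_right φ c Q P
    definite := fun P hP => by
      by_contra h
      exact (h0 P h).ne' hP }

end Form

/-! ### Formal power series -/

section Series

variable {N : ℕ}

theorem mulSeries_one_apply (f g : Series N) : mulSeries f g 1 = f 1 * g 1 := by
  rw [mulSeries]
  simp only [FreeMonoid.length_one, zero_add, Finset.range_one, Finset.sum_singleton]
  rfl

/-- Separating the factorization with empty left factor gives a recursion on the word, at the cost
of shifting `f`; inductions such as the one for associativity must therefore keep `f` general. -/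
theorem mulSeries_of_mul_apply (f g : Series N) (a : Fin N) (w : Word N) :
    mulSeries f g (FreeMonoid.of a * w) = f 1 * g (FreeMonoid.of a * w) +
      mulSeries (fun u => f (FreeMonoid.of a * u)) g w := by
  rw [mulSeries, FreeMonoid.length_mul, FreeMonoid.length_of, add_comm 1 w.length,
    Finset.sum_range_succ', add_comm]
  rfl

theorem mulSeries_add_left (f f' g : Series N) (w : Word N) :
    mulSeries (fun u => f u + f' u) g w = mulSeries f g w + mulSeries f' g w := by
  simp only [mulSeries, add_mul, Finset.sum_add_distrib]

theorem mulSeries_const_mul_left (c : ℂ) (f g : Series N) (w : Word N) :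
    mulSeries (fun u => c * f u) g w = c * mulSeries f g w := by
  simp only [mulSeries, mul_assoc, Finset.mul_sum]

theorem mulSeries_assoc (f g h : Series N) :
    mulSeries (mulSeries f g) h = mulSeries f (mulSeries g h) := by
  funext w
  induction w using FreeMonoid.inductionOn' generalizing f with
  | one => simp only [mulSeries_one_apply, mul_assoc]
  | of_mul a w ih =>
    simp only [mulSeries_of_mul_apply, mulSeries_one_apply, mulSeries_add_left,
      mulSeries_const_mul_left, ih]
    ring

theorem mulSeries_zero_left (g : Series N) (w : Word N) : mulSeries (fun _ => 0) g w = 0 := by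
  simp [mulSeries]

theorem oneSeries_one : oneSeries N 1 = 1 := rfl

theorem oneSeries_of_mul (a : Fin N) (w : Word N) : oneSeries N (FreeMonoid.of a * w) = 0 := by
  rw [oneSeries, if_neg]
  simp

theorem one_mulSeries (g : Series N) : mulSeries (oneSeries N) g = g := by
  funext w
  induction w using FreeMonoid.inductionOn' with
  | one => rw [mulSeries_one_apply, oneSeries_one, one_mul]
  | of_mul a w _ =>
    simp only [mulSeries_of_mul_apply, oneSeries_one, one_mul, oneSeries_of_mul,
      mulSeries_zero_left, add_zero]

theorem mulSeries_eq_sum_add (f g : Series N) (w : Word N) :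
    mulSeries f g w = ∑ i ∈ Finset.range w.length,
      f (FreeMonoid.ofList (w.toList.take i)) * g (FreeMonoid.ofList (w.toList.drop i)) +
        f w * g 1 := by
  rw [mulSeries, Finset.sum_range_succ]
  congr 3
  · exact List.take_length
  · exact congrArg FreeMonoid.ofList List.drop_length

theorem mulSeries_one (f : Series N) : mulSeries f (oneSeries N) = f := by
  funext w
  rw [mulSeries_eq_sum_add, oneSeries_one, mul_one, Finset.sum_eq_zero, zero_add]
  intro i hi
  have hi := Finset.mem_range.1 hi
  rw [oneSeries, if_neg, mul_zero]
  change (w.toList.drop i).length ≠ 0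
  rw [List.length_drop]
  change w.length - i ≠ 0
  omega

/-- The left inverse of a series with non-vanishing constant coefficient. -/
noncomputable def leftInv (f : Series N) (w : Word N) : ℂ :=
  (oneSeries N w - ∑ i : Fin w.length, leftInv f (FreeMonoid.ofList (w.toList.take i)) *
    f (FreeMonoid.ofList (w.toList.drop i))) / f 1
termination_by w.length
decreasing_by
  change (w.toList.take i).length < w.length
  rw [List.length_take]
  exact (min_le_left _ _).trans_lt i.2

theorem leftInv_mulSeries {f : Series N} (hf : f 1 ≠ 0) :
    mulSeries (leftInv f) f = oneSeries N := by
  funext w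
  rw [mulSeries_eq_sum_add, leftInv, div_mul_cancel₀ _ hf,
    Fin.sum_univ_eq_sum_range (fun i => leftInv f (FreeMonoid.ofList (w.toList.take i)) *
      f (FreeMonoid.ofList (w.toList.drop i)))]
  ring

/-- The left inverse has itself a left inverse, which by associativity must be `f`. -/
theorem isInverse_leftInv {f : Series N} (hf : f 1 ≠ 0) : IsInverse f (leftInv f) := by
  have h1 := leftInv_mulSeries hf
  have h2 : leftInv f 1 ≠ 0 := by
    intro h
    have := congrFun h1 1
    rw [mulSeries_one_apply, h, zero_mul, oneSeries_one] at this
    exact zero_ne_one this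
  have h3 := leftInv_mulSeries h2
  have h4 : leftInv (leftInv f) = f := by
    rw [← mulSeries_one (leftInv (leftInv f)), ← h1, ← mulSeries_assoc, h3, one_mulSeries]
  rw [h4] at h3
  exact ⟨h3, h1⟩

/-- If the series `f n * θ` tend to `1` coefficientwise, then the inverses of the series `f n`
tend to `θ`. -/
theorem tendsto_inverse {f ψ : ℕ → Series N} {θ : Series N} (hψ : ∀ n, IsInverse (f n) (ψ n))
    (h : ∀ w, Tendsto (fun n => mulSeries (f n) θ w) atTop (𝓝 (oneSeries N w))) (w : Word N) :
    Tendsto (fun n => ψ n w) atTop (𝓝 (θ w)) := by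
  have hlen : ∀ L, ∀ w : Word N, w.length = L → Tendsto (fun n => ψ n w) atTop (𝓝 (θ w)) := by
    intro L
    induction L using Nat.strong_induction_on with
    | _ L ih =>
      intro w hw
      -- This is θ = ψ_n (f_n θ) at `w`. By induction the terms with a proper prefix tend to 0,
      -- leaving ψ_n(w) times a factor tending to 1.
      have h1 : ∀ n, θ w = ∑ i ∈ Finset.range w.length,
          ψ n (FreeMonoid.ofList (w.toList.take i)) *
            mulSeries (f n) θ (FreeMonoid.ofList (w.toList.drop i)) +
          ψ n w * mulSeries (f n) θ 1 := by
        intro n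
        rw [← mulSeries_eq_sum_add, ← mulSeries_assoc, (hψ n).2, one_mulSeries]
      have h2 : Tendsto (fun n => ∑ i ∈ Finset.range w.length,
          ψ n (FreeMonoid.ofList (w.toList.take i)) *
            mulSeries (f n) θ (FreeMonoid.ofList (w.toList.drop i))) atTop
          (𝓝 (∑ i ∈ Finset.range w.length, θ (FreeMonoid.ofList (w.toList.take i)) * 0)) := by
        refine tendsto_finsetSum _ fun i hi => ?_
        have hi := Finset.mem_range.1 hi
        refine (ih i (hw ▸ hi) _ ?_).mul ?_
        · change (w.toList.take i).length = i
          rw [List.length_take]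
          exact min_eq_left hi.le
        · have h3 := h (FreeMonoid.ofList (w.toList.drop i))
          rwa [oneSeries, if_neg] at h3
          change (w.toList.drop i).length ≠ 0
          rw [List.length_drop]
          change w.length - i ≠ 0
          omega
      simp only [mul_zero, Finset.sum_const_zero] at h2
      have h4 := (h2.const_sub (θ w)).div (h 1) one_ne_zero
      rw [sub_zero, oneSeries_one, div_one] at h4
      refine h4.congr' ?_
      filter_upwards [(h 1).eventually_ne one_ne_zero] with n hn
      rw [Pi.div_apply, div_eq_iff hn, sub_eq_iff_eq_add']
      exact h1 n
  exact hlen _ w rfl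

end Series

/-! ### The Gram–Schmidt procedure -/

section GramSchmidt

variable {E : Type*} [NormedAddCommGroup E] [InnerProductSpace ℂ E]

theorem isFwd_gramSchmidt (v : Module.Basis ℕ ℂ E) (n : ℕ) :
    IsFwd v 0 n (((‖v n - ∑ i : Fin n, inner ℂ (fwd v 0 i) (v n) • fwd v 0 i‖⁻¹ : ℝ) : ℂ) •
      (v n - ∑ i : Fin n, inner ℂ (fwd v 0 i) (v n) • fwd v 0 i)) := by
  set e := v n - ∑ i : Fin n, inner ℂ (fwd v 0 i) (v n) • fwd v 0 i with he
  have hrepr : ∀ j, n ≤ j → v.repr e j = if j = n then 1 else 0 := by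
    intro j hj
    rw [he, map_sub, map_sum, Finsupp.sub_apply, Finsupp.finsetSum_apply, Finset.sum_eq_zero,
      v.repr_self, Finsupp.single_apply, sub_zero]
    · simp only [eq_comm]
    · intro i _
      rw [map_smul, Finsupp.smul_apply, (isFwd_fwd v 0 i).repr_eq_zero j (by omega), smul_zero]
  have he0 : e ≠ 0 := by
    intro h
    have := hrepr n le_rfl
    rw [h] at this
    simp at this
  have hn : 0 < ‖e‖ := norm_pos_iff.2 he0
  have hortho : ∀ j < n, inner ℂ (fwd v 0 j) e = 0 := by
    intro j hj
    have h1 := orthonormal_iff_ite.1 (orthonormal_fwd v)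
    rw [he, inner_sub_right, inner_sum]
    simp only [inner_smul_right, h1]
    rw [Fin.sum_univ_eq_sum_range (fun i => inner ℂ (fwd v 0 i) (v n) * if j = i then 1 else 0)]
    simp [hj]
  -- Orthogonality passes from the forward vectors to the basis vectors, since each forward vector
  -- has a nonzero leading coefficient.
  have hbasis : ∀ j < n, inner ℂ (v j) e = 0 := by
    intro j
    induction j using Nat.strong_induction_on with
    | _ j ih =>
      intro hj
      have h1 := hortho j hj
      have h2 := isFwd_fwd v 0 j
      rw [inner_fwd_left v h2 (fun i _ hi => ih i (by omega) (by omega))] at h1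
      have h3 := (mul_eq_zero.1 h1).resolve_left h2.repr_pos.ne'
      rwa [zero_add] at h3
  refine ⟨?_, ?_, ?_, ?_⟩
  · rw [norm_smul, Complex.norm_real, norm_inv, norm_norm, inv_mul_cancel₀ hn.ne']
  · intro i hi
    rw [map_smul, Finsupp.smul_apply, hrepr i (by omega), if_neg (by omega), smul_zero]
  · rw [zero_add, map_smul, Finsupp.smul_apply, hrepr n le_rfl, if_pos rfl, smul_eq_mul, mul_one,
      Complex.zero_lt_real]
    exact inv_pos.2 hn
  · intro i _ hi
    rw [inner_smul_right, hbasis i (by omega), mul_zero]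

end GramSchmidt

/-! ### The inner product space of a strictly positive functional -/

section Isometry

variable {N : ℕ} (φ : QuotAlg (stationaryRel N) →ₗ[ℂ] ℂ)

theorem form_mono_mul (s : Word N) (P Q : PolyN N) :
    form φ (mono s * P) (mono s * Q) = form φ P Q := by
  induction s using FreeMonoid.inductionOn' with
  | one =>
    rw [show (mono (1 : Word N) : PolyN N) = 1 from rfl, one_mul, one_mul]
  | of_mul k s ih => rw [mono_of_mul, mul_assoc, mul_assoc, form_var_mul, if_pos rfl, ih]

theorem coeff_mono_mul_mul (s t : Word N) (P : PolyN N) :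
    (mono s * P).coeff (s * t) = P.coeff t := by
  rw [mono, MonoidAlgebra.coeff_single_mul_eq_mul_coeff t, one_mul]
  intro m' _
  exact mul_right_inj _

end Isometry

/-- A strictly positive functional turns the polynomials into an inner product space. -/
theorem exists_innerProductSpace {N : ℕ} {φ : QuotAlg (stationaryRel N) →ₗ[ℂ] ℂ}
    (hpos : StrictlyPositive φ) : ∃ (E : Type) (_ : NormedAddCommGroup E)
      (_ : InnerProductSpace ℂ E) (e : PolyN N ≃ₗ[ℂ] E),
      ∀ P Q, inner ℂ (e P) (e Q) = form φ Q P :=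
  ⟨PolyN N, (formCore φ hpos).toNormedAddCommGroup,
    InnerProductSpace.ofCore (formCore φ hpos).toCore, LinearEquiv.refl ℂ (PolyN N),
    fun _ _ => rfl⟩

theorem exists_of_mul {N : ℕ} [NeZero N] {n : ℕ} (hn : 0 < n) : ∃ (k : Fin N) (s : Word N),
    wordAt N n = FreeMonoid.of k * s ∧ wordIndex (FreeMonoid.of k * s) = n := by
  have h := wordIndex_wordAt (N := N) n
  generalize wordAt N n = w at h
  induction w using FreeMonoid.inductionOn' with
  | one => rw [wordIndex_one] at h; omega
  | of_mul k s _ => exact ⟨k, s, rfl, h⟩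

section Embedding

variable {N : ℕ} {φ : QuotAlg (stationaryRel N) →ₗ[ℂ] ℂ} {E : Type*} [NormedAddCommGroup E]
  [InnerProductSpace ℂ E] (e : PolyN N ≃ₗ[ℂ] E)

theorem norm_sq_eq_form {e : PolyN N ≃ₗ[ℂ] E} (he : ∀ P Q, inner ℂ (e P) (e Q) = form φ Q P)
    (P : PolyN N) : ‖e P‖ ^ 2 = (form φ P P).re := by
  rw [← he]
  exact (inner_self_eq_norm_sq (𝕜 := ℂ) (e P)).symm

variable [NeZero N]

/-- The basis of the monomials. -/
noncomputable def formBasis : Module.Basis ℕ ℂ E := (monoBasis N).map e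

theorem formBasis_apply (n : ℕ) : formBasis e n = e (mono (wordAt N n)) := by
  rw [formBasis, Module.Basis.map_apply, monoBasis_apply]

theorem formBasis_wordIndex (w : Word N) :
    formBasis e (wordIndex w) = e (mono w) := by
  rw [formBasis_apply, wordAt_wordIndex]

theorem formBasis_repr (P : PolyN N) (n : ℕ) :
    (formBasis e).repr (e P) n = P.coeff (wordAt N n) := by
  rw [formBasis, Module.Basis.map_repr, LinearEquiv.trans_apply, LinearEquiv.symm_apply_apply,
    monoBasis_repr]

/-- In the row of `w` only the columns of prefixes of `w` survive, and these correspond to the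
factorizations of `w`. So the array acts on polynomials as right multiplication by θ. -/
theorem sum_repr_mul_seriesArray (P : PolyN N) (θ : Series N) (w : Word N) :
    (((formBasis e).repr (e P)).sum
      fun j c => c * seriesArray θ (wordIndex w) j) = mulSeries (toSeries P) θ w := by
  set x := (formBasis e).repr (e P) with hx
  let p : ℕ → Word N := fun i => FreeMonoid.ofList (w.toList.take i)
  have hp : ∀ i ∈ Finset.range (w.length + 1), (p i).length = i := by
    intro i hi
    change (w.toList.take i).length = i
    rw [List.length_take]
    exact min_eq_left (Nat.lt_succ_iff.1 (Finset.mem_range.1 hi))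
  let S := (Finset.range (w.length + 1)).image fun i => wordIndex (p i)
  have h1 : (x.sum fun j c => c * seriesArray θ (wordIndex w) j) =
      ∑ j ∈ S, x j * seriesArray θ (wordIndex w) j := by
    rw [Finsupp.sum]
    apply Finset.sum_congr_of_eq_on_inter
    · intro j _ hj
      rw [seriesArray, if_neg, mul_zero]
      intro hpre
      rw [wordAt_wordIndex] at hpre
      apply hj
      refine Finset.mem_image.2 ⟨(wordAt N j).length, Finset.mem_range.2 ?_, ?_⟩
      · exact Nat.lt_succ_of_le hpre.length_le
      · change wordIndex (FreeMonoid.ofList (w.toList.take (wordAt N j).toList.length)) = j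
        rw [← List.prefix_iff_eq_take.1 hpre, FreeMonoid.ofList_toList, wordIndex_wordAt]
    · intro j _ hj
      rw [Finsupp.notMem_support_iff.1 hj, zero_mul]
    · intros
      rfl
  rw [h1, Finset.sum_image, mulSeries]
  · refine Finset.sum_congr rfl fun i hi => ?_
    rw [seriesArray, wordAt_wordIndex, wordAt_wordIndex, if_pos, hp i hi, hx, formBasis_repr,
      wordAt_wordIndex]
    · rfl
    · exact List.take_prefix _ _
  · intro i hi j hj hij
    rw [← hp i hi, ← hp j hj, wordIndex_injective hij]

variable {e}

theorem kernel_eq_gram (he : ∀ P Q, inner ℂ (e P) (e Q) = form φ Q P) :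
    kernel φ =
    Matrix.of fun k j => inner ℂ (formBasis e k) (formBasis e j) := by
  ext k j
  rw [Matrix.of_apply, formBasis_apply, formBasis_apply, he]
  rfl

theorem map_orthoPoly (he : ∀ P Q, inner ℂ (e P) (e Q) = form φ Q P) (n : ℕ) :
    e (orthoPoly φ n) = fwd (formBasis e) 0 n := by
  induction n using Nat.strong_induction_on with
  | _ n ih =>
    refine Eq.trans ?_ (IsFwd.unique _ (isFwd_gramSchmidt (formBasis e) n)
      (isFwd_fwd (formBasis e) 0 n))
    have h1 : e (mono (wordAt N n) -
        ∑ i : Fin n, form φ (mono (wordAt N n)) (orthoPoly φ i) • orthoPoly φ i) =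
        formBasis e n - ∑ i : Fin n,
          inner ℂ (fwd (formBasis e) 0 i) (formBasis e n) •
            fwd (formBasis e) 0 i := by
      rw [map_sub, map_sum, formBasis_apply]
      congr 1
      refine Finset.sum_congr rfl fun i _ => ?_
      rw [← ih i i.2, he, map_smul]
    rw [← h1, orthoPoly]
    rw [← norm_sq_eq_form he, Real.sqrt_sq (norm_nonneg _), map_smul]

/-- With σ_{n+1} = kσ, the nonempty words before kσ either start with another letter, and are
orthogonal to X_k φ_σ outright, or are kτ with τ before σ, where the orthogonality of φ_σ applies.
-/
theorem isFwd_shiftedPoly (he : ∀ P Q, inner ℂ (e P) (e Q) = form φ Q P)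
    (n : ℕ) : IsFwd (formBasis e) 1 n
    (e (shiftedPoly φ (wordAt N (n + 1)).toList)) := by
  obtain ⟨k, s, hs, hi⟩ := exists_of_mul (N := N) (Nat.succ_pos n)
  have hsh : shiftedPoly φ (wordAt N (n + 1)).toList =
      var k * orthoPoly φ (wordIndex s) := by
    rw [hs, FreeMonoid.toList_of_mul, shiftedPoly, FreeMonoid.ofList_toList]
  rw [hsh]
  have hf := isFwd_fwd (formBasis e) 0 (wordIndex s)
  rw [← map_orthoPoly he] at hf
  have hsupp : ∀ t : Word N, wordIndex s < wordIndex t →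
      (orthoPoly φ (wordIndex s)).coeff t = 0 := by
    intro t ht
    have := hf.repr_eq_zero (wordIndex t) (by omega)
    rwa [formBasis_repr, wordAt_wordIndex] at this
  refine ⟨?_, ?_, ?_, ?_⟩
  · have h1 := norm_sq_eq_form he (orthoPoly φ (wordIndex s))
    have h2 := norm_sq_eq_form he (var k * orthoPoly φ (wordIndex s))
    rw [form_var_mul, if_pos rfl, ← h1, hf.norm_eq] at h2
    rwa [pow_left_inj₀ (norm_nonneg _) zero_le_one two_ne_zero] at h2
  · intro i hi'
    rw [formBasis_repr]
    rcases Nat.eq_zero_or_pos i with rfl | h0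
    · rw [wordAt]
      exact coeff_var_mul_one _ _
    · obtain ⟨l, t, ht, hit⟩ := exists_of_mul (N := N) h0
      rw [ht, coeff_var_mul]
      split_ifs with hkl
      · subst hkl
        apply hsupp
        rw [← wordIndex_of_mul_lt_iff k, hi, hit]
        omega
      · rfl
  · rw [formBasis_repr, add_comm 1 n, hs, coeff_var_mul, if_pos rfl]
    have := hf.repr_pos
    rwa [zero_add, formBasis_repr, wordAt_wordIndex] at this
  · intro i h1 h2
    obtain ⟨l, t, ht, hit⟩ := exists_of_mul (N := N) h1
    rw [formBasis_apply, he, ht, mono_of_mul, form_var_mul]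
    split_ifs with hkl
    · subst hkl
      have h3 : wordIndex t < wordIndex s := by
        rw [← wordIndex_of_mul_lt_iff k, hi, hit]
        omega
      have := hf.inner_eq_zero (wordIndex t) (Nat.zero_le _) (by omega)
      rwa [formBasis_wordIndex, he] at this
    · rfl

/-- By uniqueness of forward vectors X_k φ_σ is the one in the Szegő recursion, and its parameter is
γ_{0,n+1}; unitality matches the starting values. -/
theorem map_sharpPoly (he : ∀ P Q, inner ℂ (e P) (e Q) = form φ Q P)
    (hunit : φ 1 = 1) (n : ℕ) :
    e (sharpPoly φ n) = bwd (formBasis e) 0 n := by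
  induction n with
  | zero =>
    have h1 : formBasis e 0 = e 1 := by
      rw [formBasis_apply, wordAt]
      rfl
    have h2 := norm_sq_eq_form he 1
    rw [form_one_one, hunit, Complex.one_re] at h2
    have h2 := (pow_eq_one_iff_of_nonneg (norm_nonneg _) two_ne_zero).1 h2
    rw [bwd_zero, h1, h2, inv_one, Complex.ofReal_one, one_smul, sharpPoly]
  | succ n ih =>
    have h1 : param (kernel φ) 0 (n + 1) = refl (formBasis e) 0 n := by
      have h2 := reflFamily_add (formBasis e) 0 n
      rw [zero_add] at h2
      rw [kernel_eq_gram he, ← h2]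
      exact congrFun (congrFun (param_eq_reflFamily (formBasis e)) 0) (n + 1)
    have h3 : e (shiftedPoly φ (wordAt N (n + 1)).toList) =
        fwd (formBasis e) (0 + 1) n :=
      IsFwd.unique _ (isFwd_shiftedPoly he n) (isFwd_fwd _ _ _)
    rw [sharpPoly, h1, map_smul, map_add, map_neg, map_smul, ih, h3, bwd_succ, neg_add_eq_sub]

/-! ### The spectral factor of a stationary kernel -/

/-- Strip common first letters. Either the letters differ and the form vanishes, or `s` becomes
empty and φ_k^♯ is orthogonal to X_t once k reaches the index of `t`. -/
theorem eventually_form_mono_eq_zero (he : ∀ P Q, inner ℂ (e P) (e Q) = form φ Q P)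
    (hunit : φ 1 = 1) {s t : Word N}
    (h : wordIndex s < wordIndex t) :
    ∀ᶠ k in atTop, form φ (mono t) (mono s * sharpPoly φ k) = 0 := by
  induction s using FreeMonoid.inductionOn' generalizing t with
  | one =>
    filter_upwards [eventually_ge_atTop (wordIndex t)] with k hk
    have h1 := (isBwd_bwd (formBasis e) 0 k).inner_eq_zero (wordIndex t) h (by omega)
    rw [← map_sharpPoly he hunit, inner_eq_zero_symm, formBasis_wordIndex,
      he] at h1
    rwa [show (mono (1 : Word N) : PolyN N) = 1 from rfl, one_mul]
  | of_mul l s ih =>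
    induction t using FreeMonoid.inductionOn' with
    | one => rw [wordIndex_one] at h; omega
    | of_mul l' t _ =>
      simp only [mono_of_mul, mul_assoc, form_var_mul]
      split_ifs with hl
      · subst hl
        exact ih ((wordIndex_of_mul_lt_iff _).1 h)
      · exact Filter.Eventually.of_forall fun _ => rfl

/-- Left multiplication by X_s is isometric and order preserving, so it carries the peak of φ_k^♯ at
the empty word to `s`. -/
theorem isPeakSeq_mono_mul_sharpPoly (he : ∀ P Q, inner ℂ (e P) (e Q) = form φ Q P)
    (hunit : φ 1 = 1) (s : Word N) :
    IsPeakSeq (formBasis e) (wordIndex s) fun k => e (mono s * sharpPoly φ k) := by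
  have hb : ∀ k, IsBwd (formBasis e) 0 k (e (sharpPoly φ k)) := fun k => by
    rw [map_sharpPoly he hunit]
    exact isBwd_bwd _ 0 k
  have hc : ∀ k, (formBasis e).repr (e (mono s * sharpPoly φ k))
      (wordIndex s) = (formBasis e).repr (e (sharpPoly φ k)) 0 := by
    intro k
    have h1 := coeff_mono_mul_mul s 1 (sharpPoly φ k)
    rw [mul_one] at h1
    rw [formBasis_repr, wordAt_wordIndex, h1, formBasis_repr, wordAt]
  refine ⟨fun k => ?_, fun k i hi => ?_, fun k => ?_, fun k => ?_, fun i hi => ?_⟩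
  · have h1 := norm_sq_eq_form he (mono s * sharpPoly φ k)
    rw [form_mono_mul, ← norm_sq_eq_form he, (hb k).norm_eq] at h1
    rwa [pow_left_inj₀ (norm_nonneg _) zero_le_one two_ne_zero] at h1
  · rw [formBasis_repr, mono, MonoidAlgebra.coeff_single_mul_of_forall_mul_ne]
    intro d hd
    have h1 : ¬ wordIndex (s * d) < wordIndex (s * 1) := by
      rw [wordIndex_mul_lt_iff, wordIndex_one]
      omega
    rw [hd, wordIndex_wordAt, mul_one] at h1
    exact h1 hi
  · rw [hc]
    exact (hb k).repr_pos
  · rw [hc, formBasis_wordIndex, he]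
    have h1 := form_mono_mul φ s 1 (sharpPoly φ k)
    rw [mul_one] at h1
    rw [h1]
    have h2 := (hb k).repr_mul_inner
    rwa [formBasis_apply, he, wordAt] at h2
  · have := eventually_form_mono_eq_zero he hunit (s := s) (t := wordAt N i)
      (by rwa [wordIndex_wordAt])
    filter_upwards [this] with k hk
    rwa [formBasis_apply, he]

variable {Θ : Matrix ℕ ℕ ℂ}

theorem IsSpectralFactor.tendsto_form (he : ∀ P Q, inner ℂ (e P) (e Q) = form φ Q P)
    (hunit : φ 1 = 1) (hS : SzegoClass (kernel φ))
    (hΘ : IsSpectralFactor (kernel φ) Θ) (s t : Word N) :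
    Tendsto (fun k => form φ (mono t) (mono s * sharpPoly φ k)) atTop
      (𝓝 (Θ (wordIndex s) (wordIndex t))) := by
  obtain ⟨Θ₀, hΘ₀, hd⟩ := hS
  rw [kernel_eq_gram he] at hΘ hΘ₀
  have h1 := (hΘ.tendsto hΘ₀ (hd _) (isPeakSeq_mono_mul_sharpPoly he hunit s)).1 (wordIndex t)
  simpa only [formBasis_wordIndex, he] using h1

/-- The spectral factor of a stationary kernel is the array of a formal power series. -/
theorem IsSpectralFactor.eq_seriesArray (he : ∀ P Q, inner ℂ (e P) (e Q) = form φ Q P)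
    (hunit : φ 1 = 1) (hS : SzegoClass (kernel φ))
    (hΘ : IsSpectralFactor (kernel φ) Θ) : Θ = seriesArray fun w : Word N => Θ (wordIndex w) 0 := by
  have key : ∀ t s : Word N, Θ (wordIndex s) (wordIndex t) = if t.toList <+: s.toList then
      Θ (wordIndex (FreeMonoid.ofList (s.toList.drop t.length))) 0 else 0 := by
    intro t
    induction t using FreeMonoid.inductionOn' with
    | one =>
      intro s
      rw [if_pos (by simp)]
      rfl
    | of_mul l t ih =>
      intro s
      induction s using FreeMonoid.inductionOn' with
      | one =>
        rw [if_neg (by simp)]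
        refine tendsto_nhds_unique (hΘ.tendsto_form he hunit hS _ _)
          (tendsto_const_nhds.congr' ?_)
        filter_upwards [eventually_form_mono_eq_zero he hunit (s := 1) (t := FreeMonoid.of l * t)
          (wordIndex_pos_of_mul l t)]
          with k hk using hk.symm
      | of_mul l' s _ =>
        have h1 := hΘ.tendsto_form he hunit hS (FreeMonoid.of l' * s) (FreeMonoid.of l * t)
        simp only [mono_of_mul, mul_assoc, form_var_mul] at h1
        simp only [FreeMonoid.toList_of_mul, List.cons_prefix_cons]
        by_cases hl : l = l'
        · subst hl
          simp only [if_true, true_and] at h1 ⊢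
          -- After cancelling the common letter, the entries at (ls, lt) and (s, t) are limits of
          -- the same sequence.
          rw [tendsto_nhds_unique h1 (hΘ.tendsto_form he hunit hS s t), ih,
            FreeMonoid.length_mul, FreeMonoid.length_of, add_comm 1, List.drop_succ_cons]
        · simp only [hl, if_false, false_and] at h1 ⊢
          exact tendsto_nhds_unique h1 tendsto_const_nhds
  ext m n
  rw [seriesArray, ← key, wordIndex_wordAt, wordIndex_wordAt]

end Embedding

end TreeSzego

theorem theorem4p1 (N : ℕ) [NeZero N] (φ : QuotAlg (stationaryRel N) →ₗ[ℂ] ℂ)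
    (hpos : StrictlyPositive φ) (hunit : φ 1 = 1) (hS : SzegoClass (kernel φ)) :
    (∀ w : Word N, Tendsto (fun n => toSeries (orthoPoly φ n) w) atTop (𝓝 0)) ∧
    ∃ θ : Series N, spectralFactor (kernel φ) = seriesArray θ ∧
      ∃ ψ : ℕ → Series N, (∀ n, IsInverse (toSeries (sharpPoly φ n)) (ψ n)) ∧
        ∀ w : Word N, Tendsto (fun n => ψ n w) atTop (𝓝 (θ w)) := by
  obtain ⟨E, _, _, e, he⟩ := exists_innerProductSpace hpos
  obtain ⟨Θ₀, hΘ₀, hd⟩ := id hS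
  have hcoeff : ∀ (P : PolyN N) (w : Word N),
      (formBasis e).repr (e P) (wordIndex w) = toSeries P w := by
    intro P w
    rw [formBasis_repr, wordAt_wordIndex]
    rfl
  have hΘ : IsSpectralFactor (kernel φ) (spectralFactor (kernel φ)) :=
    Classical.epsilon_spec ⟨Θ₀, hΘ₀⟩
  have harr := hΘ.eq_seriesArray he hunit hS
  have hinv : ∀ n, IsInverse (toSeries (sharpPoly φ n)) (leftInv (toSeries (sharpPoly φ n))) := by
    intro n
    apply isInverse_leftInv
    have h1 := (isBwd_bwd (formBasis e) 0 n).repr_pos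
    rw [← map_sharpPoly he hunit, ← wordIndex_one (N := N), hcoeff] at h1
    exact h1.ne'
  refine ⟨fun w => ?_, _, harr, _, hinv, tendsto_inverse hinv fun w => ?_⟩
  · rw [kernel_eq_gram he] at hΘ₀
    have h1 := hΘ₀.tendsto_repr_fwd hd (wordIndex w)
    simpa only [← map_orthoPoly he, hcoeff] using h1
  · have h1 := isPeakSeq_mono_mul_sharpPoly he hunit 1
    generalize spectralFactor (kernel φ) = Θ at hΘ harr
    rw [kernel_eq_gram he] at hΘ hΘ₀
    have h2 := (hΘ.tendsto hΘ₀ (hd _) h1).2 (wordIndex w)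
    generalize (fun w : Word N => Θ (wordIndex w) 0) = θ at harr
    subst harr
    simp only [sum_repr_mul_seriesArray, show (mono (1 : Word N) : PolyN N) = 1 from rfl,
      one_mul] at h2
    convert h2 using 2
    rw [oneSeries]
    congr 1
    rw [wordIndex_injective.eq_iff]
    exact propext FreeMonoid.length_eq_zero
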